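/- Let $\mathcal V$ be a braided monoidal closed category whose underlying category is locally presentable, with braiding $c$. Write $\mathbf{Mon}(\mathcal V)$ and $\mathbf{Comon}(\mathcal V)$ for the categories of monoids and comonoids in $\mathcal V$; both are monoidal categories under the tensor product of $\mathcal V$. For a comonoid $C$ and a monoid $B$, the internal hom $[C,B]$ is a monoid under convolution, and this gives, for each monoid $B$, a functor $[-,B]^{\mathrm{op}}\colon \mathbf{Comon}(\mathcal V)\to\mathbf{Mon}(\mathcal V)^{\mathrm{op}}$. Then each of these functors has a right adjoint $P(-,B)\colon\mathbf{Mon}(\mathcal V)^{\mathrm{op}}\to\mathbf{Comon}(\mathcal V)$, that is, there are natural bijections $$\mathbf{Mon}(\mathcal V)(A,[C,B])\cong\mathbf{Comon}(\mathcal V)(C,P(A,B)).$$ The comonoid $P(A,B)$ is called the universal measuring comonoid, and the morphism $\mathrm{ev}_{A,B}\colon P(A,B)\otimes A\to B$ of $\mathcal V$ corresponding to the counit $A\to[P(A,B),B]$ the universal measuring. For every choice of these adjoints the following hold. 1. The category $\mathbf{Mon}(\mathcal V)^{\mathrm{op}}$ is enriched in the monoidal category $\mathbf{Comon}(\mathcal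 V)$, with hom-objects $\mathbf{Mon}(\mathcal V)^{\mathrm{op}}(A,B)=P(B,A)$. Its underlying ordinary category is $\mathbf{Mon}(\mathcal V)^{\mathrm{op}}$, where a monoid morphism $f\colon A\to B$ corresponds to the comonoid morphism $I\to P(A,B)$ whose composite $A\cong I\otimes A\to P(A,B)\otimes A\xrightarrow{\mathrm{ev}}B$ is $f$; and its composition $P(B,C)\otimes P(A,B)\to P(A,C)$ is the comonoid morphism that corresponds to the measuring $\mathrm{ev}_{B,C}\cdot(1\otimes\mathrm{ev}_{A,B})$. If the braiding of $\mathcal V$ is moreover a symmetry, so that $\mathbf{Mon}(\mathcal V)$, $\mathbf{Mon}(\mathcal V)^{\mathrm{op}}$ and $\mathbf{Comon}(\mathcal V)$ are symmetric monoidal categories, then: 2. The $\mathbf{Comon}(\mathcal V)$-category $\mathbf{Mon}(\mathcal V)^{\mathrm{op}}$ of part 1 carries a structure of a symmetric monoidal $\mathbf{Comon}(\mathcal V)$-category with underlying symmetric monoidal category $\mathbf{Mon}(\mathcal V)^{\mathrm{op}}$: the tensor product is the underlying functor of a $\mathbf{Comon}(\mathcal V)$-functor of two variables, and the associativity, unit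 and symmetry isomorphisms are $\mathbf{Comon}(\mathcal V)$-natural. On hom-objects the tensor product $P(A,C)\otimes P(B,D)\to P(A\otimes B,C\otimes D)$ corresponds to the measuring $(\mathrm{ev}_{A,C}\otimes\mathrm{ev}_{B,D})\cdot(1\otimes c\otimes 1)$. 3. $\mathbf{Mon}(\mathcal V)$ is a symmetric monoidal $\mathbf{Comon}(\mathcal V)$-category too, in the same sense, with hom-objects $\mathbf{Mon}(\mathcal V)(A,B)=P(A,B)$, with underlying symmetric monoidal category $\mathbf{Mon}(\mathcal V)$, and with composition and tensor product of hom-objects given (for the composition, after the symmetry $P(A,B)\otimes P(B,C)\cong P(B,C)\otimes P(A,B)$) by the same formulas. -/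

import Mathlib

open CategoryTheory MonoidalCategory Opposite
open scoped MonObj ComonObj

universe v u v₁ u₁

namespace SweedlerTheory

section Convolution

variable {V : Type u} [Category.{v} V] [MonoidalCategory.{v} V] [MonoidalClosed V]

/-- The unit of the convolution monoid `[C, B]`: the transpose of `ε ≫ η : C ⟶ I ⟶ B`. -/
def convOne (C B : V) [ComonObj C] [MonObj B] : 𝟙_ V ⟶ (ihom C).obj B :=
  MonoidalClosed.curry ((ρ_ C).hom ≫ ε[C] ≫ η[B])

lemma uncurry_convOne (C B : V) [ComonObj C] [MonObj B] :
    MonoidalClosed.uncurry (convOne C B) = (ρ_ C).hom ≫ ε[C] ≫ η[B] := by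
  rw [convOne, MonoidalClosed.uncurry_curry]

lemma uncurry_id (C B : V) :
    MonoidalClosed.uncurry (𝟙 ((ihom C).obj B)) = (ihom.ev C).app B := by
  rw [MonoidalClosed.uncurry_eq, MonoidalCategory.whiskerLeft_id, Category.id_comp]

variable [BraidedCategory V]

/-- The multiplication of the convolution monoid `[C, B]`: the transpose of
`C ⊗ ([C, B] ⊗ [C, B]) ⟶ (C ⊗ C) ⊗ ([C, B] ⊗ [C, B]) ⟶ (C ⊗ [C, B]) ⊗ (C ⊗ [C, B])
⟶ B ⊗ B ⟶ B`, built from the comultiplication of `C`, the braiding, evaluation and the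
multiplication of `B`. -/
def convMul (C B : V) [ComonObj C] [MonObj B] :
    (ihom C).obj B ⊗ (ihom C).obj B ⟶ (ihom C).obj B :=
  MonoidalClosed.curry (Δ[C] ▷ _ ≫ tensorμ C C _ _ ≫
    ((ihom.ev C).app B ⊗ₘ (ihom.ev C).app B) ≫ μ[B])

lemma uncurry_tensor_convMul {C B X Y : V} [ComonObj C] [MonObj B]
    (f : X ⟶ (ihom C).obj B) (g : Y ⟶ (ihom C).obj B) :
    MonoidalClosed.uncurry ((f ⊗ₘ g) ≫ convMul C B) =
      Δ[C] ▷ _ ≫ tensorμ C C X Y ≫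
        (MonoidalClosed.uncurry f ⊗ₘ MonoidalClosed.uncurry g) ≫ μ[B] := by
  rw [MonoidalClosed.uncurry_natural_left, convMul, MonoidalClosed.uncurry_curry,
    whisker_exchange_assoc, tensorμ_natural_right_assoc, MonoidalClosed.uncurry_eq,
    MonoidalClosed.uncurry_eq, tensorHom_comp_tensorHom_assoc]

lemma uncurry_convMul (C B : V) [ComonObj C] [MonObj B] :
    MonoidalClosed.uncurry (convMul C B) = Δ[C] ▷ _ ≫ tensorμ C C _ _ ≫
      ((ihom.ev C).app B ⊗ₘ (ihom.ev C).app B) ≫ μ[B] := by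
  rw [convMul, MonoidalClosed.uncurry_curry]

lemma conv_one_mul (C B : V) [ComonObj C] [MonObj B] :
    convOne C B ▷ _ ≫ convMul C B = (λ_ _).hom := by
  apply MonoidalClosed.uncurry_injective
  rw [← tensorHom_id, uncurry_tensor_convMul, uncurry_convOne, uncurry_id,
    MonoidalClosed.uncurry_eq]
  have h {Z : V} (e : Z ⟶ B) : ((ρ_ C).hom ≫ ε[C] ≫ η[B] ⊗ₘ e) ≫ μ[B] =
      (ε[C] ▷ 𝟙_ V ⊗ₘ 𝟙 Z) ≫ ((ρ_ (𝟙_ V)).hom ▷ _) ≫ (λ_ _).hom ≫ e := by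
    have h1 : ((ρ_ C).hom ≫ ε[C] ≫ η[B] ⊗ₘ e) =
        (ε[C] ▷ 𝟙_ V ⊗ₘ 𝟙 Z) ≫ ((ρ_ (𝟙_ V)).hom ⊗ₘ e) ≫ η[B] ▷ _ := by
      rw [← tensorHom_id η[B], tensorHom_comp_tensorHom, tensorHom_comp_tensorHom]
      simp
    rw [h1, Category.assoc, Category.assoc, MonObj.one_mul,
      MonoidalCategory.tensorHom_def (ρ_ (𝟙_ V)).hom e, Category.assoc, leftUnitor_naturality]
  rw [h, ← id_whiskerRight C, ← tensorμ_natural_left_assoc, tensorHom_id,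
    ← comp_whiskerRight_assoc, ComonObj.counit_comul]
  simp only [tensorμ, braiding_tensorUnit_right]
  simp only [Functor.id_obj, ← Category.assoc]
  congr 1
  monoidal

lemma conv_mul_one (C B : V) [ComonObj C] [MonObj B] :
    _ ◁ convOne C B ≫ convMul C B = (ρ_ _).hom := by
  apply MonoidalClosed.uncurry_injective
  rw [← id_tensorHom, uncurry_tensor_convMul, uncurry_convOne, uncurry_id,
    MonoidalClosed.uncurry_eq]
  have h {Z : V} (e : Z ⟶ B) : (e ⊗ₘ (ρ_ C).hom ≫ ε[C] ≫ η[B]) ≫ μ[B] =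
      (𝟙 Z ⊗ₘ ε[C] ▷ 𝟙_ V) ≫ (_ ◁ (ρ_ (𝟙_ V)).hom) ≫ (ρ_ _).hom ≫ e := by
    have h1 : (e ⊗ₘ (ρ_ C).hom ≫ ε[C] ≫ η[B]) =
        (𝟙 Z ⊗ₘ ε[C] ▷ 𝟙_ V) ≫ (e ⊗ₘ (ρ_ (𝟙_ V)).hom) ≫ _ ◁ η[B] := by
      rw [← id_tensorHom _ η[B], tensorHom_comp_tensorHom, tensorHom_comp_tensorHom]
      simp
    rw [h1, Category.assoc, Category.assoc, MonObj.mul_one,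
      MonoidalCategory.tensorHom_def' e (ρ_ (𝟙_ V)).hom, Category.assoc, rightUnitor_naturality]
  rw [h, ← id_whiskerRight C, ← tensorμ_natural_left_assoc, id_tensorHom,
    ← comp_whiskerRight_assoc, ComonObj.comul_counit]
  simp only [tensorμ, braiding_tensorUnit_left]
  simp only [Functor.id_obj, ← Category.assoc]
  congr 1
  monoidal

lemma conv_mul_assoc (C B : V) [ComonObj C] [MonObj B] :
    convMul C B ▷ _ ≫ convMul C B =
      (α_ _ _ _).hom ≫ _ ◁ convMul C B ≫ convMul C B := by
  apply MonoidalClosed.uncurry_injective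
  rw [← tensorHom_id, ← id_tensorHom, uncurry_tensor_convMul,
    MonoidalClosed.uncurry_natural_left, uncurry_tensor_convMul, uncurry_convMul, uncurry_id]
  generalize (ihom.ev C).app B = e
  dsimp only [Functor.comp_obj, Functor.id_obj] at e ⊢
  generalize (ihom C).obj B = H at e ⊢
  change C ⊗ H ⟶ B at e
  have hl : (Δ[C] ▷ (H ⊗ H) ≫ tensorμ C C H H ≫ (e ⊗ₘ e) ≫ μ[B] ⊗ₘ e) ≫ μ[B] =
      (Δ[C] ▷ (H ⊗ H) ⊗ₘ 𝟙 C ▷ H) ≫ tensorμ C C H H ▷ (C ⊗ H) ≫ (α_ _ _ _).hom ≫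
        (e ⊗ₘ e ⊗ₘ e) ≫ B ◁ μ[B] ≫ μ[B] := by
    have h1 : (Δ[C] ▷ (H ⊗ H) ≫ tensorμ C C H H ≫ (e ⊗ₘ e) ≫ μ[B] ⊗ₘ e) =
        (Δ[C] ▷ (H ⊗ H) ⊗ₘ 𝟙 C ▷ H) ≫ tensorμ C C H H ▷ (C ⊗ H) ≫
          ((e ⊗ₘ e) ⊗ₘ e) ≫ μ[B] ▷ B := by
      rw [← tensorHom_id (tensorμ C C H H), ← tensorHom_id μ[B]]
      simp only [tensorHom_comp_tensorHom, id_whiskerRight, Category.id_comp, Category.comp_id]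
    rw [h1, ← associator_naturality_assoc, ← MonObj.mul_assoc]
    simp only [Category.assoc]
  have hr : (e ⊗ₘ Δ[C] ▷ (H ⊗ H) ≫ tensorμ C C H H ≫ (e ⊗ₘ e) ≫ μ[B]) ≫ μ[B] =
      (𝟙 C ▷ H ⊗ₘ Δ[C] ▷ (H ⊗ H)) ≫ (C ⊗ H) ◁ tensorμ C C H H ≫
        (e ⊗ₘ e ⊗ₘ e) ≫ B ◁ μ[B] ≫ μ[B] := by
    have h1 : (e ⊗ₘ Δ[C] ▷ (H ⊗ H) ≫ tensorμ C C H H ≫ (e ⊗ₘ e) ≫ μ[B]) =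
        (𝟙 C ▷ H ⊗ₘ Δ[C] ▷ (H ⊗ H)) ≫ (C ⊗ H) ◁ tensorμ C C H H ≫
          (e ⊗ₘ e ⊗ₘ e) ≫ B ◁ μ[B] := by
      rw [← id_tensorHom _ (tensorμ C C H H), ← id_tensorHom B μ[B]]
      simp only [tensorHom_comp_tensorHom, id_whiskerRight, Category.id_comp, Category.comp_id]
    rw [h1]
    simp only [Category.assoc]
  rw [hl, hr, ← tensorμ_natural_left_assoc, ← tensorμ_natural_left_assoc, tensorHom_id,
    id_tensorHom, associator_monoidal_assoc, ← comp_whiskerRight_assoc, whisker_exchange_assoc,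
    whisker_exchange_assoc (C ◁ Δ[C]), ← comp_whiskerRight_assoc, ComonObj.comul_assoc,
    MonoidalCategory.tensorHom_def]
  simp only [comp_whiskerRight, Category.assoc]

/-- The convolution monoid `[C, B]` of a comonoid `C` and a monoid `B`. -/
def convMon (C : Comon V) (B : Mon V) : Mon V where
  X := (ihom C.X).obj B.X
  mon :=
    { one := convOne C.X B.X
      mul := convMul C.X B.X
      one_mul := conv_one_mul C.X B.X
      mul_one := conv_mul_one C.X B.X
      mul_assoc := conv_mul_assoc C.X B.X }

/-- The functor `[-, B]ᵒᵖ : Comon(V) ⥤ Mon(V)ᵒᵖ` sending a comonoid `C` to the convolution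
monoid `[C, B]`. -/
def convFunctor (B : Mon V) : Comon V ⥤ (Mon V)ᵒᵖ where
  obj C := op (convMon C B)
  map {C D} f := Quiver.Hom.op
    { hom := (MonoidalClosed.pre f.hom).app B.X
      isMonHom_hom :=
        { one_hom := by
            change convOne D.X B.X ≫ _ = convOne C.X B.X
            apply MonoidalClosed.uncurry_injective
            rw [MonoidalClosed.uncurry_pre_app, uncurry_convOne, uncurry_convOne]
            simp
          mul_hom := by
            change convMul D.X B.X ≫ _ = (_ ⊗ₘ _) ≫ convMul C.X B.X
            apply MonoidalClosed.uncurry_injective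
            rw [MonoidalClosed.uncurry_pre_app, uncurry_tensor_convMul, convMul,
              MonoidalClosed.uncurry_curry, MonoidalClosed.uncurry_pre,
              ← comp_whiskerRight_assoc, IsComonHom.hom_comul, comp_whiskerRight_assoc,
              tensorμ_natural_left_assoc, tensorHom_comp_tensorHom_assoc] } }
  map_id C := by
    apply Quiver.Hom.unop_inj
    ext
    change (MonoidalClosed.pre (𝟙 C.X)).app B.X = 𝟙 _
    rw [MonoidalClosed.pre_id]
    rfl
  map_comp f g := by
    apply Quiver.Hom.unop_inj
    ext
    change (MonoidalClosed.pre (f.hom ≫ g.hom)).app B.X = _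
    rw [MonoidalClosed.pre_map]
    rfl

end Convolution

section SymmetricComonoids

variable {V : Type u} [Category.{v} V] [MonoidalCategory.{v} V] [SymmetricCategory V]

lemma tensorμ_comp_braiding (X Y : V) :
    tensorμ X Y X Y ≫ (β_ (X ⊗ X) (Y ⊗ Y)).hom =
      ((β_ X Y).hom ⊗ₘ (β_ X Y).hom) ≫ tensorμ Y X Y X := by
  simp only [tensorμ, Category.assoc, BraidedCategory.braiding_tensor_right_hom,
    BraidedCategory.braiding_tensor_left_hom, comp_whiskerRight, whisker_assoc,
    MonoidalCategory.whiskerLeft_comp, pentagon_assoc, pentagon_inv_hom_hom_hom_inv_assoc,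
    Iso.inv_hom_id_assoc, whiskerLeft_hom_inv_assoc]
  slice_lhs 3 4 =>
    rw [← MonoidalCategory.whiskerLeft_comp, ← comp_whiskerRight, SymmetricCategory.symmetry]
  simp only [id_whiskerRight, MonoidalCategory.whiskerLeft_id, Category.id_comp, Category.assoc,
    pentagon_inv_assoc, Iso.hom_inv_id_assoc]
  slice_lhs 1 2 =>
    rw [← associator_inv_naturality_left]
  slice_lhs 2 3 =>
    rw [Iso.inv_hom_id]
  rw [Category.id_comp]
  slice_lhs 2 3 =>
    rw [← associator_naturality_right]
  slice_lhs 1 2 =>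
    rw [← MonoidalCategory.tensorHom_def]
  simp only [Category.assoc]

lemma tensorμ_tensorμ (W X Y Z : V) : tensorμ W X Y Z ≫ tensorμ W Y X Z = 𝟙 _ := by
  have h : tensorμ W Y X Z = tensorδ W X Y Z := by
    simp only [tensorμ, tensorδ, SymmetricCategory.braiding_swap_eq_inv_braiding X Y]
  rw [h, tensorμ_tensorδ]

lemma comul_braiding (X Y : V) [ComonObj X] [ComonObj Y] :
    (β_ X Y).hom ≫ Δ[Y ⊗ X] = Δ[X ⊗ Y] ≫ ((β_ X Y).hom ⊗ₘ (β_ X Y).hom) := by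
  have h : tensorμ X X Y Y ≫ ((β_ X Y).hom ⊗ₘ (β_ X Y).hom) =
      (β_ (X ⊗ X) (Y ⊗ Y)).hom ≫ tensorμ Y Y X X := by
    have h1 := congrArg (fun t => tensorμ X X Y Y ≫ t ≫ tensorμ Y Y X X)
      (tensorμ_comp_braiding X Y)
    simp only [Category.assoc, tensorμ_tensorμ, Category.comp_id] at h1
    rw [← h1, ← Category.assoc, tensorμ_tensorμ, Category.id_comp]
  rw [Comon.tensorObj_comul, Comon.tensorObj_comul, Category.assoc, h,
    BraidedCategory.braiding_naturality_assoc]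

instance isComonHom_braiding (X Y : V) [ComonObj X] [ComonObj Y] :
    IsComonHom (β_ X Y).hom where
  hom_counit := by
    rw [Comon.tensorObj_counit, Comon.tensorObj_counit,
      ← BraidedCategory.braiding_naturality_assoc, braiding_leftUnitor,
      MonoidalCategory.unitors_equal]
  hom_comul := comul_braiding X Y

/-- The symmetry of two comonoids, given by the symmetry of the underlying objects. -/
def comonBraiding (X Y : Comon V) : X ⊗ Y ≅ Y ⊗ X :=
  haveI : @IsComonHom V _ _ (X ⊗ Y).X (Y ⊗ X).X _ _ (β_ X.X Y.X).hom :=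
    isComonHom_braiding X.X Y.X
  Comon.mkIso' (M := X ⊗ Y) (N := Y ⊗ X) (β_ X.X Y.X)

/-- The braiding of the comonoids in a symmetric monoidal category is the braiding of the
underlying objects. -/
instance comonBraided : BraidedCategory (Comon V) :=
  BraidedCategory.ofFaithful (Comon.forget V) comonBraiding (fun X Y => by
    change 𝟙 _ ≫ (β_ X.X Y.X).hom = (β_ X.X Y.X).hom ≫ 𝟙 _
    simp)

instance comonSymmetric : SymmetricCategory (Comon V) where
  symmetry X Y := Comon.ext (SymmetricCategory.symmetry X.X Y.X)

end SymmetricComonoids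

section OppositeSymmetric

/-- The opposite of a symmetric monoidal category is symmetric. -/
instance symmetricOpposite {A : Type u} [Category.{v} A] [MonoidalCategory A]
    [SymmetricCategory A] : SymmetricCategory Aᵒᵖ where
  symmetry X Y := Quiver.Hom.unop_inj (SymmetricCategory.symmetry X.unop Y.unop)

end OppositeSymmetric

section EnrichedMonoidal

variable (W : Type u) [Category.{v} W] [MonoidalCategory W]
  (A : Type u₁) [Category.{v₁} A] [MonoidalCategory A] [EnrichedOrdinaryCategory W A]

/-- A monoidal `W`-category structure on a `W`-category whose underlying ordinary category is the
monoidal category `A`: a `W`-functor `A ⊗ A ⟶ A` on the tensor product of `W`-categories whose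
underlying functor is the tensor product of `A`, such that the associator and the unitors of `A`
are `W`-natural. -/
structure EnrichedMonoidalStructure [BraidedCategory W] where
  /-- The action on hom-objects of the tensor product `W`-functor. -/
  tensorMap (X₁ Y₁ X₂ Y₂ : A) :
    EnrichedCategory.Hom (V := W) X₁ Y₁ ⊗ EnrichedCategory.Hom X₂ Y₂ ⟶
      EnrichedCategory.Hom (X₁ ⊗ X₂) (Y₁ ⊗ Y₂)
  /-- The tensor product preserves identities. -/
  tensorMap_id (X₁ X₂ : A) :
    (λ_ (𝟙_ W)).inv ≫ (eId W X₁ ⊗ₘ eId W X₂) ≫ tensorMap X₁ X₁ X₂ X₂ = eId W (X₁ ⊗ X₂)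
  /-- The tensor product preserves composition; the composition of the `W`-category `A ⊗ A`
  interchanges the two middle factors by means of the braiding of `W`. -/
  tensorMap_comp (X₁ Y₁ Z₁ X₂ Y₂ Z₂ : A) :
    (tensorMap X₁ Y₁ X₂ Y₂ ⊗ₘ tensorMap Y₁ Z₁ Y₂ Z₂) ≫
        eComp W (X₁ ⊗ X₂) (Y₁ ⊗ Y₂) (Z₁ ⊗ Z₂) =
      tensorμ _ _ _ _ ≫ (eComp W X₁ Y₁ Z₁ ⊗ₘ eComp W X₂ Y₂ Z₂) ≫ tensorMap X₁ Z₁ X₂ Z₂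
  /-- The underlying functor is the tensor product of `A`. -/
  tensorMap_homEquiv {X₁ Y₁ X₂ Y₂ : A} (f : X₁ ⟶ Y₁) (g : X₂ ⟶ Y₂) :
    (λ_ (𝟙_ W)).inv ≫ (eHomEquiv W f ⊗ₘ eHomEquiv W g) ≫ tensorMap X₁ Y₁ X₂ Y₂ =
      eHomEquiv W (f ⊗ₘ g)
  /-- The associator is `W`-natural. -/
  associator_natural (X₁ Y₁ X₂ Y₂ X₃ Y₃ : A) :
    tensorMap X₁ Y₁ X₂ Y₂ ▷ _ ≫ tensorMap (X₁ ⊗ X₂) (Y₁ ⊗ Y₂) X₃ Y₃ ≫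
        eHomWhiskerLeft W ((X₁ ⊗ X₂) ⊗ X₃) (α_ Y₁ Y₂ Y₃).hom =
      (α_ _ _ _).hom ≫ _ ◁ tensorMap X₂ Y₂ X₃ Y₃ ≫ tensorMap X₁ Y₁ (X₂ ⊗ X₃) (Y₂ ⊗ Y₃) ≫
        eHomWhiskerRight W (α_ X₁ X₂ X₃).hom (Y₁ ⊗ Y₂ ⊗ Y₃)
  /-- The left unitor is `W`-natural. -/
  leftUnitor_natural (X Y : A) :
    (λ_ _).inv ≫ eId W (𝟙_ A) ▷ _ ≫ tensorMap (𝟙_ A) (𝟙_ A) X Y ≫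
        eHomWhiskerLeft W (𝟙_ A ⊗ X) (λ_ Y).hom =
      eHomWhiskerRight W (λ_ X).hom Y
  /-- The right unitor is `W`-natural. -/
  rightUnitor_natural (X Y : A) :
    (ρ_ _).inv ≫ _ ◁ eId W (𝟙_ A) ≫ tensorMap X Y (𝟙_ A) (𝟙_ A) ≫
        eHomWhiskerLeft W (X ⊗ 𝟙_ A) (ρ_ Y).hom =
      eHomWhiskerRight W (ρ_ X).hom Y

/-- A symmetric monoidal `W`-category structure, for a symmetric monoidal `W`, on a `W`-category
whose underlying ordinary category is the symmetric monoidal category `A`: a monoidal `W`-category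
structure such that the symmetry of `A` is `W`-natural. -/
structure EnrichedSymmetricMonoidalStructure [SymmetricCategory W] [SymmetricCategory A] extends
    EnrichedMonoidalStructure W A where
  /-- The symmetry is `W`-natural. -/
  braiding_natural (X₁ Y₁ X₂ Y₂ : A) :
    tensorMap X₁ Y₁ X₂ Y₂ ≫ eHomWhiskerLeft W (X₁ ⊗ X₂) (β_ Y₁ Y₂).hom =
      (β_ _ _).hom ≫ tensorMap X₂ Y₂ X₁ Y₁ ≫ eHomWhiskerRight W (β_ X₁ X₂).hom (Y₂ ⊗ Y₁)

end EnrichedMonoidal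

section Sweedler

variable (V : Type u) [Category.{v} V] [MonoidalCategory.{v} V] [MonoidalClosed V]

/-- A choice, for every monoid `B`, of a right adjoint `P(-, B) : Mon(V)ᵒᵖ ⥤ Comon(V)` of
`[-, B]ᵒᵖ : Comon(V) ⥤ Mon(V)ᵒᵖ`. -/
structure SweedlerHom [BraidedCategory V] where
  /-- The functor `P(-, B)`. -/
  rightAdj (B : Mon V) : (Mon V)ᵒᵖ ⥤ Comon V
  /-- The adjunction `[-, B]ᵒᵖ ⊣ P(-, B)`. -/
  adj (B : Mon V) : convFunctor B ⊣ rightAdj B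

namespace SweedlerHom

variable {V}

section Braided

variable [BraidedCategory V] (S : SweedlerHom V)

/-- The universal measuring comonoid `P(A, B)`. -/
def P (A B : Mon V) : Comon V := (S.rightAdj B).obj (op A)

/-- The universal measuring `P(A, B) ⊗ A ⟶ B`, the transpose of the counit
`A ⟶ [P(A, B), B]` of the adjunction. -/
def ev (A B : Mon V) : (S.P A B).X ⊗ A.X ⟶ B.X :=
  MonoidalClosed.uncurry (((S.adj B).counit.app (op A)).unop.hom)

/-- An enrichment in `Comon(V)` of the ordinary category `Mon(V)ᵒᵖ`, with hom-objects
`Mon(V)ᵒᵖ(A, B) = P(B, A)` and with the composition and the identification of the underlying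
category that the universal measurings determine. -/
structure IsOpEnrichment (E : EnrichedOrdinaryCategory (Comon V) (Mon V)ᵒᵖ) : Prop where
  hom_eq (A B : (Mon V)ᵒᵖ) : E.Hom A B = S.P B.unop A.unop
  /-- The element of `P(A, B)` that corresponds to a morphism of monoids `f : A ⟶ B` acts on `A`
  as `f`. -/
  homEquiv_ev {A B : Mon V} (f : A ⟶ B) :
    (λ_ A.X).inv ≫ (E.homEquiv f.op ≫ eqToHom (hom_eq (op B) (op A))).hom ▷ A.X ≫ S.ev A B =
      f.hom
  /-- Composition corresponds to the composition of measurings. -/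
  comp_ev (A B C : Mon V) :
    (E.comp (op C) (op B) (op A) ≫ eqToHom (hom_eq (op C) (op A))).hom ▷ A.X ≫ S.ev A C =
      ((eqToHom (hom_eq (op C) (op B))).hom ⊗ₘ (eqToHom (hom_eq (op B) (op A))).hom) ▷ A.X ≫
        (α_ _ _ _).hom ≫ _ ◁ S.ev A B ≫ S.ev B C

end Braided

section Symmetric

variable [SymmetricCategory V] (S : SweedlerHom V)

/-- An enrichment in `Comon(V)` of the ordinary category `Mon(V)`, with hom-objects
`Mon(V)(A, B) = P(A, B)` and with the composition and the identification of the underlying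
category that the universal measurings determine. -/
structure IsEnrichment (E : EnrichedOrdinaryCategory (Comon V) (Mon V)) : Prop where
  hom_eq (A B : Mon V) : E.Hom A B = S.P A B
  /-- The element of `P(A, B)` that corresponds to a morphism of monoids `f : A ⟶ B` acts on `A`
  as `f`. -/
  homEquiv_ev {A B : Mon V} (f : A ⟶ B) :
    (λ_ A.X).inv ≫ (E.homEquiv f ≫ eqToHom (hom_eq A B)).hom ▷ A.X ≫ S.ev A B = f.hom
  /-- Composition corresponds, after the symmetry, to the composition of measurings. -/
  comp_ev (A B C : Mon V) :
    (E.comp A B C ≫ eqToHom (hom_eq A C)).hom ▷ A.X ≫ S.ev A C =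
      ((eqToHom (hom_eq A B)).hom ⊗ₘ (eqToHom (hom_eq B C)).hom) ▷ A.X ≫
        (β_ _ _).hom ▷ A.X ≫ (α_ _ _ _).hom ≫ _ ◁ S.ev A B ≫ S.ev B C

/-- The tensor product of hom-objects `P(A, C) ⊗ P(B, D) ⟶ P(A ⊗ B, C ⊗ D)` of an enrichment
of `Mon(V)ᵒᵖ` corresponds to the tensor product of measurings. -/
def OpTensorCompatible {E : EnrichedOrdinaryCategory (Comon V) (Mon V)ᵒᵖ}
    (h : S.IsOpEnrichment E) (T : EnrichedMonoidalStructure (Comon V) (Mon V)ᵒᵖ) : Prop :=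
  ∀ A B C D : Mon V,
    (T.tensorMap (op C) (op A) (op D) (op B) ≫
        eqToHom (h.hom_eq (op (C ⊗ D)) (op (A ⊗ B)))).hom ▷ (A.X ⊗ B.X) ≫
          S.ev (A ⊗ B) (C ⊗ D) =
      ((eqToHom (h.hom_eq (op C) (op A))).hom ⊗ₘ (eqToHom (h.hom_eq (op D) (op B))).hom) ▷ _ ≫
        tensorμ _ _ _ _ ≫ (S.ev A C ⊗ₘ S.ev B D)

/-- The tensor product of hom-objects `P(A, C) ⊗ P(B, D) ⟶ P(A ⊗ B, C ⊗ D)` of an enrichment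
of `Mon(V)` corresponds to the tensor product of measurings. -/
def TensorCompatible {E : EnrichedOrdinaryCategory (Comon V) (Mon V)}
    (h : S.IsEnrichment E) (T : EnrichedMonoidalStructure (Comon V) (Mon V)) : Prop :=
  ∀ A B C D : Mon V,
    (T.tensorMap A C B D ≫ eqToHom (h.hom_eq (A ⊗ B) (C ⊗ D))).hom ▷ (A.X ⊗ B.X) ≫
        S.ev (A ⊗ B) (C ⊗ D) =
      ((eqToHom (h.hom_eq A C)).hom ⊗ₘ (eqToHom (h.hom_eq B D)).hom) ▷ _ ≫
        tensorμ _ _ _ _ ≫ (S.ev A C ⊗ₘ S.ev B D)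

end Symmetric

end SweedlerHom

end Sweedler

end SweedlerTheory

/-! Existence of `P(-, B)`. A cocontinuous functor on a cocomplete category with an essentially
small dense subcategory is a left adjoint (`isLeftAdjoint_of_isDense`). Colimits of comonoids are
computed in `V`, and `[-, B]` turns them into limits, so `convFunctor B` is cocontinuous. The
substance is density (`isDense_presentableComon`): if `V` is locally `κ`-presentable with `κ`
uncountable, the comonoids with `κ`-presentable underlying object are dense. The underlying object
of a comonoid `C` is the `κ`-filtered colimit of the presentable objects over it, and it is enough
that the presentable comonoids over `C` are final among these. Since the tensor product commutes
with filtered colimits, the comultiplication of `C`, restricted to a presentable object, lifts to a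
stage of the diagram, and each comonoid law then holds at a later stage (`exists_isNext`). Iterating
gives a sequence whose colimit is a comonoid over `C`, still presentable because `κ` is uncountable
(`ComulApprox.exists_comon`).

Enrichment. By transposition, comonoid morphisms `C ⟶ P(A, B)` are the same as measurings `C ⊗ A ⟶
B` (`isMeasuring_uncurry_iff`, `hom_ext`, `exists_act_eq`). Measurings compose, in the symmetric
case they can be tensored, and those by the unit comonoid are the monoid morphisms. Hence every
structure morphism is defined by a measuring, and every axiom becomes an equation between actions in
`V`, which follows from coherence. The composition of measurings has its factors in the order
required for `Mon(V)ᵒᵖ`; for `Mon(V)` the symmetry exchanges them. -/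

namespace SweedlerTheory

open Limits

/-! ### Colimits and essential smallness of comonoids. -/

section ComonoidColimits

variable {V : Type u} [Category.{v} V] [MonoidalCategory.{v} V] {J : Type u₁} [Category.{v₁} J]

/-- Comonoids in `V` are the opposite of monoids in `Vᵒᵖ`, and limits of monoids are computed on
underlying objects. -/
instance hasColimitsOfShape_comon [HasColimitsOfShape J V] : HasColimitsOfShape J (Comon V) := by
  have : HasLimitsOfShape Jᵒᵖ Vᵒᵖ := hasLimitsOfShape_opposite_opposite_iff.mpr inferInstance
  have : HasColimitsOfShape J (Mon Vᵒᵖ)ᵒᵖ := hasColimitsOfShape_op_of_hasLimitsOfShape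
  exact Adjunction.hasColimitsOfShape_of_equivalence (Comon.Comon_EquivMon_OpOp V).functor

instance preservesColimitsOfShape_comon_forget [HasColimitsOfShape J V] :
    PreservesColimitsOfShape J (Comon.forget V) := by
  have : HasLimitsOfShape Jᵒᵖ Vᵒᵖ := hasLimitsOfShape_opposite_opposite_iff.mpr inferInstance
  have : PreservesColimitsOfShape J (Mon.forget Vᵒᵖ).leftOp := preservesColimitsOfShape_leftOp _ _
  have : (Comon.ComonToMonOpOp V).IsEquivalence :=
    (Comon.Comon_EquivMon_OpOp V).isEquivalence_functor
  exact preservesColimitsOfShape_of_natIso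
    (NatIso.ofComponents (fun _ => Iso.refl _)
      (fun _ => (Category.comp_id _).trans (Category.id_comp _).symm) :
      Comon.ComonToMonOpOp V ⋙ (Mon.forget Vᵒᵖ).leftOp ≅ Comon.forget V)

instance reflectsColimitsOfShape_comon_forget [HasColimitsOfShape J V] :
    ReflectsColimitsOfShape J (Comon.forget V) :=
  reflectsColimitsOfShape_of_reflectsIsomorphisms

/-- A structure of comonoid carried along an isomorphism. -/
@[reducible]
def comonObjOfIso {X Y : V} (e : X ≅ Y) [ComonObj X] : ComonObj Y where
  counit := e.inv ≫ ε[X]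
  comul := e.inv ≫ Δ[X] ≫ (e.hom ⊗ₘ e.hom)
  counit_comul := by
    rw [← cancel_epi e.hom, ← tensorHom_id]
    simp only [Category.assoc, Iso.hom_inv_id_assoc, tensorHom_comp_tensorHom, Category.comp_id,
      ComonObj.counit_comul_hom]
  comul_counit := by
    rw [← cancel_epi e.hom, ← id_tensorHom]
    simp only [Category.assoc, Iso.hom_inv_id_assoc, tensorHom_comp_tensorHom, Category.comp_id,
      ComonObj.comul_counit_hom]
  comul_assoc := by
    rw [← cancel_epi e.hom]
    simp only [Category.assoc, Iso.hom_inv_id_assoc]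
    have h1 : (e.hom ⊗ₘ e.hom) ≫ Y ◁ (e.inv ≫ Δ[X] ≫ (e.hom ⊗ₘ e.hom)) =
        X ◁ Δ[X] ≫ (e.hom ⊗ₘ (e.hom ⊗ₘ e.hom)) := by
      rw [← id_tensorHom, ← id_tensorHom, tensorHom_comp_tensorHom, tensorHom_comp_tensorHom]
      simp
    have h2 : (e.hom ⊗ₘ e.hom) ≫ (e.inv ≫ Δ[X] ≫ (e.hom ⊗ₘ e.hom)) ▷ Y =
        Δ[X] ▷ X ≫ ((e.hom ⊗ₘ e.hom) ⊗ₘ e.hom) := by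
      rw [← tensorHom_id, ← tensorHom_id, tensorHom_comp_tensorHom, tensorHom_comp_tensorHom]
      simp
    rw [h1, reassoc_of% h2, associator_naturality, ComonObj.comul_assoc_assoc]

/-- The objects with a comonoid structure on an essentially small class are essentially small. -/
instance essentiallySmall_inverseImage_comon_forget (P : ObjectProperty V)
    [ObjectProperty.EssentiallySmall.{v} P] :
    ObjectProperty.EssentiallySmall.{v} (P.inverseImage (Comon.forget V)) := by
  obtain ⟨Q, _, -, hQ⟩ := ObjectProperty.EssentiallySmall.exists_small_le.{v} P
  -- A comonoid structure is determined by two morphisms of the locally small category `V`.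
  have hsm (X : V) : Small.{v} (ComonObj X) := by
    refine small_of_injective (β := (X ⟶ 𝟙_ V) × (X ⟶ X ⊗ X))
      (f := fun c => (c.counit, c.comul)) ?_
    rintro ⟨⟩ ⟨⟩ h
    simp only [Prod.mk.injEq] at h
    obtain ⟨h1, h2⟩ := h
    subst h1 h2
    rfl
  let F : (Σ X : Subtype Q, ComonObj X.1) → Comon V := fun x => @Comon.mk V _ _ x.1.1 x.2
  refine ⟨ObjectProperty.ofObj F, inferInstance, ?_⟩
  intro C hC
  obtain ⟨Y, hY, ⟨e⟩⟩ := hQ _ hC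
  change C.X ≅ Y at e
  -- Transporting the structure to the representative `Y` makes `e` an isomorphism of comonoids.
  let _ : ComonObj Y := comonObjOfIso e
  have : IsComonHom e.hom :=
    { hom_counit := Iso.hom_inv_id_assoc e _
      hom_comul := Iso.hom_inv_id_assoc e _ }
  exact ⟨F ⟨⟨Y, hY⟩, inferInstance⟩, ObjectProperty.ofObj_apply F _,
    ⟨Comon.mkIso' (N := Comon.mk Y) e⟩⟩

end ComonoidColimits

/-! ### An adjoint functor theorem for dense subcategories. -/

section AdjointFunctor

variable {C : Type u} [Category.{v} C] {D : Type u₁} [Category.{v} D]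

/-- A cocontinuous functor on a cocomplete category with an essentially small dense subcategory is
a left adjoint. -/
lemma isLeftAdjoint_of_isDense [HasColimits C] (P : ObjectProperty C)
    [ObjectProperty.EssentiallySmall.{v} P] [P.ι.IsDense] (F : C ⥤ D) [PreservesColimits F] :
    F.IsLeftAdjoint := by
  have (X : D) : HasTerminal (CostructuredArrow F X) := by
    let E (Y : C) : CostructuredArrow P.ι Y ≌ SmallModel.{v} (CostructuredArrow P.ι Y) :=
      equivSmallModel _
    have hpres (Y : C) : PreservesColimitsOfShape (CostructuredArrow P.ι Y) F :=
      preservesColimitsOfShape_of_equiv (E Y).symm F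
    have hcol : HasColimitsOfShape (CostructuredArrow (P.ι ⋙ F) X) (CostructuredArrow F X) :=
      hasColimitsOfShape_of_equivalence
        (equivSmallModel.{v} (CostructuredArrow (P.ι ⋙ F) X)).symm
    -- The colimit `T` of all objects `F Y ⟶ X` with `Y` in `P` is weakly terminal in the comma
    -- category.
    let G := CostructuredArrow.pre P.ι F X
    let T : CostructuredArrow F X := colimit G
    have hT (Y : (CostructuredArrow F X)ᵒᵖ) : Nonempty (op T ⟶ Y) := by
      obtain ⟨Y⟩ := Y
      let K : CostructuredArrow P.ι Y.left ⥤ CostructuredArrow (P.ι ⋙ F) X :=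
        { obj Z := CostructuredArrow.mk (Y := Z.left) (F.map Z.hom ≫ Y.hom)
          map f := CostructuredArrow.homMk f.left (by
            have := CostructuredArrow.w f
            dsimp at this ⊢
            rw [← this, F.map_comp, Category.assoc]) }
      let s : Cocone (CostructuredArrow.proj P.ι Y.left ⋙ P.ι) :=
        ⟨T.left,
          { app Z := (colimit.ι G (K.obj Z)).left
            naturality Z Z' f :=
              (congrArg CommaMorphism.left (colimit.w G (K.map f))).trans
                (Category.comp_id _).symm }⟩
      -- By density `Y.left` is the colimit of the objects of `P` over it; the legs of `T` at their
      -- images are compatible and glue to `d`.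
      have hc : IsColimit _ := P.ι.denseAt Y.left
      obtain ⟨d, hd⟩ : ∃ d : Y.left ⟶ T.left, ∀ Z : CostructuredArrow P.ι Y.left,
          Z.hom ≫ d = (colimit.ι G (K.obj Z)).left :=
        ⟨hc.desc s, fun Z =>
          (congrArg (· ≫ hc.desc s) (Category.id_comp Z.hom).symm).trans (hc.fac s Z)⟩
      refine ⟨Quiver.Hom.op (CostructuredArrow.homMk d ?_)⟩
      refine (isColimitOfPreserves F hc).hom_ext fun Z => ?_
      have h : F.map (colimit.ι G (K.obj Z)).left ≫ T.hom = F.map Z.hom ≫ Y.hom :=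
        CostructuredArrow.w (colimit.ι G (K.obj Z))
      change F.map (𝟙 _ ≫ Z.hom) ≫ F.map d ≫ T.hom = F.map (𝟙 _ ≫ Z.hom) ≫ Y.hom
      rw [Category.id_comp, ← h, ← hd, F.map_comp, Category.assoc]
    -- A weakly terminal object can be corrected to a terminal one by a wide coequalizer; the dual
    -- statement is applied to the opposite category.
    have := hasInitial_of_weakly_initial_and_hasWideEqualizers hT
    exact hasTerminal_of_hasInitial_op
  exact isLeftAdjoint_of_costructuredArrowTerminals F

end AdjointFunctor

end SweedlerTheory
namespace SweedlerTheory

open Limits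

/-! ### Cocontinuity of the convolution functor. -/

section ConvolutionColimits

variable {V : Type u} [Category.{v} V] [MonoidalCategory.{v} V] [MonoidalClosed V]
  [BraidedCategory V]

/-- On underlying objects this is the internal hom into `B`, which turns colimits in its first
argument into limits; the forgetful functor of monoids reflects these limits. -/
instance preservesColimitsOfShape_convFunctor (B : Mon V) {J : Type u₁} [Category.{v₁} J]
    [HasColimitsOfShape J V] : PreservesColimitsOfShape J (convFunctor B) := by
  have : PreservesColimitsOfShape Jᵒᵖᵒᵖ (Comon.forget V) :=
    preservesColimitsOfShape_of_equiv (opOpEquivalence J).symm _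
  have : PreservesLimitsOfShape Jᵒᵖ ((Comon.forget V).op) := preservesLimitsOfShape_op _ _
  have : PreservesLimitsOfShape Jᵒᵖ ((convFunctor B).leftOp ⋙ Mon.forget V) :=
    preservesLimitsOfShape_of_natIso
      (NatIso.ofComponents (fun _ => Iso.refl _)
        (fun _ => (Category.comp_id _).trans (Category.id_comp _).symm) :
        (Comon.forget V).op ⋙ MonoidalClosed.internalHom.flip.obj B.X ≅
          (convFunctor B).leftOp ⋙ Mon.forget V)
  have := preservesLimitsOfShape_of_reflects_of_preserves (J := Jᵒᵖ) (convFunctor B).leftOp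
    (Mon.forget V)
  exact preservesColimitsOfShape_of_leftOp _ _

end ConvolutionColimits

section CoconeLegs

variable {C : Type u} [Category.{v} C] {J : Type u₁} [Category.{v₁} J] {F : J ⥤ C}

/-- The legs of a cocone, as morphisms to its point. -/
def coconeLeg (c : Cocone F) (j : J) : F.obj j ⟶ c.pt := c.ι.app j

lemma map_coconeLeg (c : Cocone F) {i j : J} (f : i ⟶ j) :
    F.map f ≫ coconeLeg c j = coconeLeg c i := c.w f

lemma map_coconeLeg_assoc (c : Cocone F) {i j : J} (f : i ⟶ j) {Z : C} (h : c.pt ⟶ Z) :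
    F.map f ≫ coconeLeg c j ≫ h = coconeLeg c i ≫ h :=
  (reassoc_of% (map_coconeLeg c f)) h

lemma coconeLeg_hom_ext {c : Cocone F} (hc : IsColimit c) {X : C} {f g : c.pt ⟶ X}
    (h : ∀ j, coconeLeg c j ≫ f = coconeLeg c j ≫ g) : f = g :=
  hc.hom_ext h

end CoconeLegs

/-! ### Filtered colimits and the tensor product. -/

section FilteredTensor

variable {V : Type u} [Category.{v} V] [MonoidalCategory.{v} V]
  {J : Type u₁} [Category.{v₁} J] {F G : J ⥤ V}

/-- The pointwise tensor product of two cocones. -/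
def tensorCocone (c : Cocone F) (d : Cocone G) : Cocone (F ⊗ G) :=
  ⟨c.pt ⊗ d.pt,
    { app j := coconeLeg c j ⊗ₘ coconeLeg d j
      naturality i j f := by
        change (F.map f ⊗ₘ G.map f) ≫ (coconeLeg c j ⊗ₘ coconeLeg d j) =
          (coconeLeg c i ⊗ₘ coconeLeg d i) ≫ 𝟙 _
        rw [tensorHom_comp_tensorHom, map_coconeLeg, map_coconeLeg, Category.comp_id] }⟩

/-- Filtered colimits commute with the tensor product if the latter preserves colimits in each
variable. -/
lemma nonempty_isColimit_tensorCocone [IsFiltered J]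
    [∀ X : V, PreservesColimitsOfShape J (tensorLeft X)]
    [∀ X : V, PreservesColimitsOfShape J (tensorRight X)]
    {c : Cocone F} (hc : IsColimit c) {d : Cocone G} (hd : IsColimit d) :
    Nonempty (IsColimit (tensorCocone c d)) := by
  have h1 (X : V) : PreservesColimit G ((curriedTensor V).obj X) :=
    inferInstanceAs (PreservesColimit G (tensorLeft X))
  have h2 (X : V) : PreservesColimit F ((curriedTensor V).flip.obj X) :=
    inferInstanceAs (PreservesColimit F (tensorRight X))
  -- Preservation in each variable gives a colimit over `J × J`; the diagonal of a filtered category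
  -- is final.
  have h := isColimitOfPreserves₂ (curriedTensor V) hc hd
  have h' := (Functor.Final.isColimitWhiskerEquiv (Functor.diag J) _).symm h
  let e : Functor.diag J ⋙ Functor.uncurry.obj
      ((((Functor.whiskeringLeft₂ V).obj F).obj G).obj (curriedTensor V)) ≅ F ⊗ G :=
    NatIso.ofComponents (fun _ => Iso.refl _) (by
      intro i j f
      simp [MonoidalCategory.tensorHom_def])
  exact ⟨IsColimit.equivOfNatIsoOfIso e
    (Cocone.whisker (Functor.diag J) ((curriedTensor V).mapCocone₂ c d)) (tensorCocone c d)
    (Cocone.ext (Iso.refl _)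
    fun j => (Category.comp_id _).trans ((Category.id_comp _).trans
      (MonoidalCategory.tensorHom_def (coconeLeg c j) (coconeLeg d j)).symm)) h'⟩

end FilteredTensor

/-! ### Comonoids as colimits of sequences of approximate comonoids. -/

section SequentialComonoids

variable {V : Type u} [Category.{v} V] [MonoidalCategory.{v} V]

/-- A sequence of objects with approximate comultiplications and counits satisfying
the axioms of a comonoid asymptotically. -/
structure ComonSequence (G : ℕ ⥤ V) where
  /-- The approximate counits. -/
  counit (n : ℕ) : G.obj n ⟶ 𝟙_ V
  /-- The approximate comultiplications. -/
  comul (n : ℕ) : G.obj n ⟶ G.obj (n + 1) ⊗ G.obj (n + 1)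
  map_counit (n : ℕ) : G.map (homOfLE n.le_succ) ≫ counit (n + 1) = counit n
  map_comul (n : ℕ) : G.map (homOfLE n.le_succ) ≫ comul (n + 1) =
    comul n ≫ (G.map (homOfLE (n + 1).le_succ) ⊗ₘ G.map (homOfLE (n + 1).le_succ))
  comul_assoc (n : ℕ) :
    comul n ≫ (comul (n + 1) ⊗ₘ G.map (homOfLE (n + 1).le_succ)) ≫ (α_ _ _ _).hom =
      comul n ≫ (G.map (homOfLE (n + 1).le_succ) ⊗ₘ comul (n + 1))
  counit_comul (n : ℕ) :
    comul n ≫ counit (n + 1) ▷ _ ≫ (λ_ _).hom ≫ G.map (homOfLE (n + 1).le_succ) =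
      G.map (homOfLE n.le_succ) ≫ G.map (homOfLE (n + 1).le_succ)
  comul_counit (n : ℕ) :
    comul n ≫ _ ◁ counit (n + 1) ≫ (ρ_ _).hom ≫ G.map (homOfLE (n + 1).le_succ) =
      G.map (homOfLE n.le_succ) ≫ G.map (homOfLE (n + 1).le_succ)

namespace ComonSequence

variable {G : ℕ ⥤ V} (S : ComonSequence G) {d : Cocone G} (hd : IsColimit d)

/-- The counit of the colimit. -/
def colimitCounit : d.pt ⟶ 𝟙_ V :=
  hd.desc ⟨𝟙_ V, NatTrans.ofSequence S.counit fun n =>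
    (S.map_counit n).trans (Category.comp_id _).symm⟩

/-- The comultiplication of the colimit. -/
def colimitComul : d.pt ⟶ d.pt ⊗ d.pt :=
  hd.desc ⟨d.pt ⊗ d.pt,
    NatTrans.ofSequence
      (fun n => S.comul n ≫ (coconeLeg d (n + 1) ⊗ₘ coconeLeg d (n + 1))) fun n => by
      rw [reassoc_of% S.map_comul n, tensorHom_comp_tensorHom, map_coconeLeg]
      exact (Category.comp_id _).symm⟩

lemma cocone_colimitCounit (n : ℕ) : coconeLeg d n ≫ S.colimitCounit hd = S.counit n :=
  hd.fac _ n

lemma cocone_colimitComul (n : ℕ) :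
    coconeLeg d n ≫ S.colimitComul hd = S.comul n ≫ (coconeLeg d (n + 1) ⊗ₘ coconeLeg d (n + 1)) :=
  hd.fac _ n

/-- The comonoid structure on the colimit of a sequence of approximate comonoids. -/
@[reducible]
def colimitComonObj : ComonObj d.pt where
  counit := S.colimitCounit hd
  comul := S.colimitComul hd
  -- The approximate law holds only after the transition to stage `n + 2`, so a leg at `n + 1` is
  -- factored through that stage.
  counit_comul := coconeLeg_hom_ext hd fun n => by
    rw [reassoc_of% cocone_colimitComul, ← tensorHom_id, tensorHom_comp_tensorHom, Category.comp_id,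
      cocone_colimitCounit, MonoidalCategory.tensorHom_def,
      ← cancel_mono (λ_ d.pt).hom, Category.assoc, Category.assoc, leftUnitor_naturality,
      ← map_coconeLeg d (homOfLE (n + 1).le_succ), reassoc_of% S.counit_comul n, map_coconeLeg,
      map_coconeLeg, Category.assoc,
      Iso.inv_hom_id, Category.comp_id]
  comul_counit := coconeLeg_hom_ext hd fun n => by
    rw [reassoc_of% cocone_colimitComul, ← id_tensorHom, tensorHom_comp_tensorHom, Category.comp_id,
      cocone_colimitCounit, MonoidalCategory.tensorHom_def',
      ← cancel_mono (ρ_ d.pt).hom, Category.assoc, Category.assoc, rightUnitor_naturality,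
      ← map_coconeLeg d (homOfLE (n + 1).le_succ), reassoc_of% S.comul_counit n, map_coconeLeg,
      map_coconeLeg, Category.assoc,
      Iso.inv_hom_id, Category.comp_id]
  -- On one tensor factor the next comultiplication is applied and on the other the transition map,
  -- so that both land at stage `n + 2`.
  comul_assoc := coconeLeg_hom_ext hd fun n => by
    have h1 : S.comul n ≫ (coconeLeg d (n + 1) ⊗ₘ coconeLeg d (n + 1)) ≫ d.pt ◁ S.colimitComul hd =
        S.comul n ≫ (G.map (homOfLE (n + 1).le_succ) ⊗ₘ S.comul (n + 1)) ≫
          (coconeLeg d (n + 2) ⊗ₘ (coconeLeg d (n + 2) ⊗ₘ coconeLeg d (n + 2))) := by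
      rw [← id_tensorHom, tensorHom_comp_tensorHom, tensorHom_comp_tensorHom, Category.comp_id,
        cocone_colimitComul, map_coconeLeg]
    have h2 : S.comul n ≫ (coconeLeg d (n + 1) ⊗ₘ coconeLeg d (n + 1)) ≫ S.colimitComul hd ▷ d.pt =
        S.comul n ≫ (S.comul (n + 1) ⊗ₘ G.map (homOfLE (n + 1).le_succ)) ≫
          ((coconeLeg d (n + 2) ⊗ₘ coconeLeg d (n + 2)) ⊗ₘ coconeLeg d (n + 2)) := by
      rw [← tensorHom_id, tensorHom_comp_tensorHom, tensorHom_comp_tensorHom, Category.comp_id,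
        cocone_colimitComul, map_coconeLeg]
    rw [reassoc_of% cocone_colimitComul, reassoc_of% cocone_colimitComul, h1, reassoc_of% h2,
      associator_naturality, ← reassoc_of% S.comul_assoc n]

end ComonSequence

end SequentialComonoids

end SweedlerTheory
namespace SweedlerTheory

open Limits

section PresentableLegs

variable {C : Type u} [Category.{v} C] {J : Type u₁} [Category.{v₁} J] {F : J ⥤ C} {c : Cocone F}

lemma exists_comp_coconeLeg_eq (κ : Cardinal.{v}) [Fact κ.IsRegular] [EssentiallySmall.{v} J]
    [IsCardinalFiltered J κ] {X : C} [IsCardinalPresentable X κ] (hc : IsColimit c) (f : X ⟶ c.pt) :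
    ∃ (j : J) (g : X ⟶ F.obj j), g ≫ coconeLeg c j = f :=
  IsCardinalPresentable.exists_hom_of_isColimit κ hc f

lemma exists_comp_map_eq (κ : Cardinal.{v}) [Fact κ.IsRegular] [EssentiallySmall.{v} J]
    [IsCardinalFiltered J κ] {X : C} [IsCardinalPresentable X κ] (hc : IsColimit c) {i : J}
    (f g : X ⟶ F.obj i)
    (h : f ≫ coconeLeg c i = g ≫ coconeLeg c i) :
    ∃ (j : J) (t : i ⟶ j), f ≫ F.map t = g ≫ F.map t :=
  IsCardinalPresentable.exists_eq_of_isColimit' κ hc f g h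

end PresentableLegs

/-! ### Lifting a comultiplication along a filtered diagram. -/

section ApproximateComultiplication

variable {V : Type u} [Category.{v} V] [MonoidalCategory.{v} V] {J : Type u₁} [Category.{v₁} J]
  {F : J ⥤ V}

/-- An approximation, in a diagram whose colimit is a comonoid, of its comultiplication. -/
structure ComulApprox (c : Cocone F) [ComonObj c.pt] where
  /-- The index of the source. -/
  src : J
  /-- The index of the factors of the target. -/
  tgt : J
  /-- The transition from the source to the target. -/
  map : src ⟶ tgt
  /-- The approximate comultiplication. -/
  comul : F.obj src ⟶ F.obj tgt ⊗ F.obj tgt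
  comul_coconeLeg : comul ≫ (coconeLeg c tgt ⊗ₘ coconeLeg c tgt) = coconeLeg c src ≫ Δ[c.pt]

namespace ComulApprox

variable {c : Cocone F} [ComonObj c.pt]

/-- The conditions for an approximate comultiplication to follow another one in a sequence that
converges to a comonoid. -/
structure IsNext (s : ComulApprox c) {k : J} (t : s.tgt ⟶ k)
    (δ : F.obj s.tgt ⟶ F.obj k ⊗ F.obj k) : Prop where
  comul_coconeLeg : δ ≫ (coconeLeg c k ⊗ₘ coconeLeg c k) = coconeLeg c s.tgt ≫ Δ[c.pt]
  map_comul : F.map s.map ≫ δ = s.comul ≫ (F.map t ⊗ₘ F.map t)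
  comul_assoc : s.comul ≫ (δ ⊗ₘ F.map t) ≫ (α_ _ _ _).hom = s.comul ≫ (F.map t ⊗ₘ δ)
  counit_comul : s.comul ≫ (coconeLeg c s.tgt ≫ ε[c.pt]) ▷ _ ≫ (λ_ _).hom ≫ F.map t =
    F.map s.map ≫ F.map t
  comul_counit : s.comul ≫ _ ◁ (coconeLeg c s.tgt ≫ ε[c.pt]) ≫ (ρ_ _).hom ≫ F.map t =
    F.map s.map ≫ F.map t

/-- The counit law of `c.pt`, read on an approximation. Being an equation in the colimit, it will
hold at a later stage by presentability; the next two lemmas serve the same purpose. -/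
lemma counit_coconeLeg (s : ComulApprox c) :
    s.comul ≫ (coconeLeg c s.tgt ≫ ε[c.pt]) ▷ _ ≫ (λ_ _).hom ≫ coconeLeg c s.tgt =
      F.map s.map ≫ coconeLeg c s.tgt := by
  rw [← leftUnitor_naturality, ← MonoidalCategory.tensorHom_def_assoc, map_coconeLeg]
  have h : (coconeLeg c s.tgt ≫ ε[c.pt] ⊗ₘ coconeLeg c s.tgt) =
      (coconeLeg c s.tgt ⊗ₘ coconeLeg c s.tgt) ≫ ε[c.pt] ▷ c.pt := by
    rw [← tensorHom_id, tensorHom_comp_tensorHom, Category.comp_id]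
  rw [h, Category.assoc, reassoc_of% s.comul_coconeLeg, ComonObj.counit_comul_assoc,
    Iso.inv_hom_id, Category.comp_id]

lemma coconeLeg_counit (s : ComulApprox c) :
    s.comul ≫ _ ◁ (coconeLeg c s.tgt ≫ ε[c.pt]) ≫ (ρ_ _).hom ≫ coconeLeg c s.tgt =
      F.map s.map ≫ coconeLeg c s.tgt := by
  rw [← rightUnitor_naturality, ← MonoidalCategory.tensorHom_def'_assoc, map_coconeLeg]
  have h : (coconeLeg c s.tgt ⊗ₘ coconeLeg c s.tgt ≫ ε[c.pt]) =
      (coconeLeg c s.tgt ⊗ₘ coconeLeg c s.tgt) ≫ c.pt ◁ ε[c.pt] := by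
    rw [← id_tensorHom, tensorHom_comp_tensorHom, Category.comp_id]
  rw [h, Category.assoc, reassoc_of% s.comul_coconeLeg, ComonObj.comul_counit_assoc,
    Iso.inv_hom_id, Category.comp_id]

lemma coassoc_coconeLeg (s : ComulApprox c) {k : J} (t : s.tgt ⟶ k)
    (δ : F.obj s.tgt ⟶ F.obj k ⊗ F.obj k)
    (h : δ ≫ (coconeLeg c k ⊗ₘ coconeLeg c k) = coconeLeg c s.tgt ≫ Δ[c.pt]) :
    (s.comul ≫ (δ ⊗ₘ F.map t) ≫ (α_ _ _ _).hom) ≫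
        (coconeLeg c k ⊗ₘ (coconeLeg c k ⊗ₘ coconeLeg c k)) =
      (s.comul ≫ (F.map t ⊗ₘ δ)) ≫ (coconeLeg c k ⊗ₘ (coconeLeg c k ⊗ₘ coconeLeg c k)) := by
  have h1 : (coconeLeg c s.tgt ≫ Δ[c.pt] ⊗ₘ coconeLeg c s.tgt) =
      (coconeLeg c s.tgt ⊗ₘ coconeLeg c s.tgt) ≫ Δ[c.pt] ▷ c.pt := by
    rw [← tensorHom_id, tensorHom_comp_tensorHom, Category.comp_id]
  have h2 : (coconeLeg c s.tgt ⊗ₘ coconeLeg c s.tgt ≫ Δ[c.pt]) =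
      (coconeLeg c s.tgt ⊗ₘ coconeLeg c s.tgt) ≫ c.pt ◁ Δ[c.pt] := by
    rw [← id_tensorHom, tensorHom_comp_tensorHom, Category.comp_id]
  simp only [Category.assoc]
  rw [← associator_naturality, tensorHom_comp_tensorHom_assoc, tensorHom_comp_tensorHom, h,
    map_coconeLeg, h1, h2, Category.assoc, reassoc_of% s.comul_coconeLeg,
    reassoc_of% s.comul_coconeLeg, ComonObj.comul_assoc]

/-- Every condition is an equation that holds in the colimit between morphisms out of a presentable
object, so it holds at some stage. Only the sources need to be presentable: the targets lie in the
diagrams `F`, `F ⊗ F` and `F ⊗ (F ⊗ F)`, and tensor products of presentable objects are not required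
to be presentable. -/
lemma exists_isNext (κ : Cardinal.{v}) [Fact κ.IsRegular] [EssentiallySmall.{v} J]
    [IsCardinalFiltered J κ] [∀ X : V, PreservesColimitsOfShape J (tensorLeft X)]
    [∀ X : V, PreservesColimitsOfShape J (tensorRight X)]
    [∀ j, IsCardinalPresentable (F.obj j) κ] (hc : IsColimit c) (s : ComulApprox c) :
    ∃ (k : J) (t : s.tgt ⟶ k) (δ : F.obj s.tgt ⟶ F.obj k ⊗ F.obj k), s.IsNext t δ := by
  have := isFiltered_of_isCardinalFiltered J κ
  obtain ⟨hc2⟩ := nonempty_isColimit_tensorCocone hc hc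
  obtain ⟨hc3⟩ := nonempty_isColimit_tensorCocone hc hc2
  -- The counit laws do not involve the new comultiplication and can be settled before it is lifted.
  obtain ⟨k1, a1, h1⟩ := exists_comp_map_eq κ hc
    (s.comul ≫ (coconeLeg c s.tgt ≫ ε[c.pt]) ▷ _ ≫ (λ_ _).hom) (F.map s.map)
    (by simpa only [Category.assoc] using s.counit_coconeLeg)
  obtain ⟨k2, a2, h2⟩ := exists_comp_map_eq κ hc
    (s.comul ≫ _ ◁ (coconeLeg c s.tgt ≫ ε[c.pt]) ≫ (ρ_ _).hom) (F.map s.map)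
    (by simpa only [Category.assoc] using s.coconeLeg_counit)
  obtain ⟨k3, δ3, h3⟩ : ∃ (k : J) (δ : F.obj s.tgt ⟶ F.obj k ⊗ F.obj k),
      δ ≫ (coconeLeg c k ⊗ₘ coconeLeg c k) = coconeLeg c s.tgt ≫ Δ[c.pt] :=
    exists_comp_coconeLeg_eq κ hc2 (coconeLeg c s.tgt ≫ Δ[c.pt])
  -- Both counit laws must hold for one and the same transition, so the two paths out of `s.tgt`
  -- have to be equalized.
  obtain ⟨k4, b1, b2, b3, h4⟩ : ∃ (k4 : J) (b1 : k1 ⟶ k4) (b2 : k2 ⟶ k4) (_ : k3 ⟶ k4),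
      a1 ≫ b1 = a2 ≫ b2 := by
    obtain ⟨k, b1, b2, h⟩ := IsFiltered.span a1 a2
    exact ⟨IsFiltered.max k k3, b1 ≫ IsFiltered.leftToMax _ _, b2 ≫ IsFiltered.leftToMax _ _,
      IsFiltered.rightToMax _ _, by rw [reassoc_of% h]⟩
  obtain ⟨k5, b5, h5⟩ : ∃ (k5 : J) (b5 : k4 ⟶ k5),
      (F.map s.map ≫ δ3 ≫ (F.map b3 ⊗ₘ F.map b3)) ≫ (F.map b5 ⊗ₘ F.map b5) =
        (s.comul ≫ (F.map (a1 ≫ b1) ⊗ₘ F.map (a1 ≫ b1))) ≫ (F.map b5 ⊗ₘ F.map b5) := by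
    refine exists_comp_map_eq (F := F ⊗ F) κ hc2 (i := k4)
      (F.map s.map ≫ δ3 ≫ (F.map b3 ⊗ₘ F.map b3))
      (s.comul ≫ (F.map (a1 ≫ b1) ⊗ₘ F.map (a1 ≫ b1))) ?_
    change (F.map s.map ≫ δ3 ≫ (F.map b3 ⊗ₘ F.map b3)) ≫ (coconeLeg c k4 ⊗ₘ coconeLeg c k4) =
      (s.comul ≫ (F.map (a1 ≫ b1) ⊗ₘ F.map (a1 ≫ b1))) ≫ (coconeLeg c k4 ⊗ₘ coconeLeg c k4)
    simp only [Category.assoc, tensorHom_comp_tensorHom, map_coconeLeg, h3, s.comul_coconeLeg,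
      map_coconeLeg_assoc]
  let t := a1 ≫ b1 ≫ b5
  let δ := δ3 ≫ (F.map (b3 ≫ b5) ⊗ₘ F.map (b3 ≫ b5))
  have hδ : δ ≫ (coconeLeg c k5 ⊗ₘ coconeLeg c k5) = coconeLeg c s.tgt ≫ Δ[c.pt] := by
    simp only [δ, Category.assoc, tensorHom_comp_tensorHom, map_coconeLeg, h3]
  -- Coassociativity comes last because it involves both `δ` and `t`; the earlier conditions survive
  -- a further transition.
  obtain ⟨k6, b6, h6⟩ : ∃ (k6 : J) (b6 : k5 ⟶ k6),
      (s.comul ≫ (δ ⊗ₘ F.map t) ≫ (α_ _ _ _).hom) ≫ (F.map b6 ⊗ₘ (F.map b6 ⊗ₘ F.map b6)) =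
        (s.comul ≫ (F.map t ⊗ₘ δ)) ≫ (F.map b6 ⊗ₘ (F.map b6 ⊗ₘ F.map b6)) :=
    exists_comp_map_eq (F := F ⊗ (F ⊗ F)) κ hc3 (i := k5)
      (s.comul ≫ (δ ⊗ₘ F.map t) ≫ (α_ _ _ _).hom) (s.comul ≫ (F.map t ⊗ₘ δ))
      (s.coassoc_coconeLeg t δ hδ)
  refine ⟨k6, t ≫ b6, δ ≫ (F.map b6 ⊗ₘ F.map b6), ?_, ?_, ?_, ?_, ?_⟩
  · rw [Category.assoc, tensorHom_comp_tensorHom, map_coconeLeg, hδ]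
  · simp only [t, δ, F.map_comp, ← tensorHom_comp_tensorHom, Category.assoc] at h5 ⊢
    rw [reassoc_of% h5]
  · simp only [F.map_comp, ← tensorHom_comp_tensorHom, Category.assoc] at h6 ⊢
    rw [associator_naturality, h6]
  · simp only [t, F.map_comp, Category.assoc] at h1 ⊢
    rw [reassoc_of% h1]
  · have ht : t = a2 ≫ b2 ≫ b5 := by simp only [t, reassoc_of% h4]
    simp only [ht, F.map_comp, Category.assoc] at h2 ⊢
    rw [reassoc_of% h2]

end ComulApprox

end ApproximateComultiplication

end SweedlerTheory
namespace SweedlerTheory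

open Limits

/-! ### The presentable comonoid generated by an approximation. -/

namespace ComulApprox

variable {V : Type u} [Category.{v} V] [MonoidalCategory.{v} V] {J : Type u₁} [Category.{v₁} J]
  {F : J ⥤ V} {c : Cocone F} [ComonObj c.pt]

section Sequence

variable (hn : ∀ s : ComulApprox c, ∃ (k : J) (t : s.tgt ⟶ k)
  (δ : F.obj s.tgt ⟶ F.obj k ⊗ F.obj k), s.IsNext t δ)

/-- A chosen successor of an approximate comultiplication. -/
noncomputable def next (s : ComulApprox c) : ComulApprox c where
  src := s.tgt
  tgt := (hn s).choose
  map := (hn s).choose_spec.choose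
  comul := (hn s).choose_spec.choose_spec.choose
  comul_coconeLeg := (hn s).choose_spec.choose_spec.choose_spec.comul_coconeLeg

lemma isNext_next (s : ComulApprox c) : s.IsNext (next hn s).map (next hn s).comul :=
  (hn s).choose_spec.choose_spec.choose_spec

/-- The sequence of chosen successors of an approximate comultiplication. -/
noncomputable def sequence (s : ComulApprox c) : ℕ → ComulApprox c
  | 0 => s
  | n + 1 => next hn (sequence s n)

/-- The sequence of indices of the sequence of chosen successors. -/
noncomputable def indexFunctor (s : ComulApprox c) : ℕ ⥤ J :=
  Functor.ofSequence (X := fun n => (sequence hn s n).src) fun n => (sequence hn s n).map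

lemma indexFunctor_map (s : ComulApprox c) (n : ℕ) :
    (indexFunctor hn s ⋙ F).map (homOfLE n.le_succ) = F.map (sequence hn s n).map :=
  congrArg F.map (Functor.ofSequence_map_homOfLE_succ _ n)

/-- The sequence of chosen successors as a sequence of approximate comonoids. -/
noncomputable def comonSequence (s : ComulApprox c) :
    ComonSequence (indexFunctor hn s ⋙ F) where
  counit n := coconeLeg c _ ≫ ε[c.pt]
  -- The source of stage `n + 1` is by definition the target of stage `n`, so this has the required
  -- type.
  comul n := (sequence hn s n).comul
  map_counit n := map_coconeLeg_assoc c ((indexFunctor hn s).map (homOfLE n.le_succ)) _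
  map_comul n := by
    rw [indexFunctor_map, indexFunctor_map]
    exact (isNext_next hn (sequence hn s n)).map_comul
  comul_assoc n := by
    rw [indexFunctor_map]
    exact (isNext_next hn (sequence hn s n)).comul_assoc
  counit_comul n := by
    rw [indexFunctor_map, indexFunctor_map]
    exact (isNext_next hn (sequence hn s n)).counit_comul
  comul_counit n := by
    rw [indexFunctor_map, indexFunctor_map]
    exact (isNext_next hn (sequence hn s n)).comul_counit

end Sequence

/-- An approximate comultiplication is realised by a comonoid with presentable underlying object
over the given one. -/
lemma exists_comon (κ : Cardinal.{v}) [Fact κ.IsRegular] (hκ : Cardinal.aleph0 < κ)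
    [EssentiallySmall.{v} J]
    [IsCardinalFiltered J κ] [∀ X : V, PreservesColimitsOfShape J (tensorLeft X)]
    [∀ X : V, PreservesColimitsOfShape J (tensorRight X)] [HasColimitsOfShape ℕ V]
    [∀ j, IsCardinalPresentable (F.obj j) κ] (hc : IsColimit c) (s : ComulApprox c) :
    ∃ (D : Comon V) (_ : IsCardinalPresentable D.X κ) (h : D ⟶ Comon.mk c.pt)
      (r : F.obj s.tgt ⟶ D.X), r ≫ h.hom = coconeLeg c s.tgt ∧
        (F.map s.map ≫ r) ≫ Δ[D.X] = s.comul ≫ (r ⊗ₘ r) := by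
  have hn := exists_isNext κ hc
  let S := comonSequence hn s
  let G := indexFunctor hn s ⋙ F
  let d := colimit.cocone G
  have hd : IsColimit d := colimit.isColimit G
  have : ∀ n, IsCardinalPresentable (G.obj n) κ := fun n => by
    dsimp [G]
    infer_instance
  let _ : ComonObj d.pt := S.colimitComonObj hd
  let e : d.pt ⟶ c.pt := hd.desc ⟨c.pt, NatTrans.ofSequence
    (fun n => coconeLeg c ((indexFunctor hn s).obj n))
    fun n => (map_coconeLeg c _).trans (Category.comp_id _).symm⟩
  have he (n : ℕ) : coconeLeg d n ≫ e = coconeLeg c ((indexFunctor hn s).obj n) := hd.fac _ n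
  have : IsComonHom e :=
    { hom_counit := coconeLeg_hom_ext hd fun n => by
        rw [reassoc_of% he n]
        exact (S.cocone_colimitCounit hd n).symm
      hom_comul := coconeLeg_hom_ext hd fun n => by
        rw [reassoc_of% he n]
        refine Eq.trans ?_ ((reassoc_of% (S.cocone_colimitComul hd n)) _).symm
        rw [tensorHom_comp_tensorHom, he]
        exact (sequence hn s n).comul_coconeLeg.symm }
  -- In the sequence `s.src` has index `0` and `s.tgt` has index `1`, hence the leg at `1`.
  refine ⟨Comon.mk d.pt, ?_, Comon.Hom.mk e, coconeLeg d 1, he 1, ?_⟩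
  · refine isCardinalPresentable_of_isColimit d hd κ ?_
    -- Uncountability of `κ` enters here: a countable colimit of `κ`-presentable objects is
    -- `κ`-presentable.
    have hN : HasCardinalLT ℕ κ := by
      rw [HasCardinalLT, Cardinal.mk_nat, Cardinal.lift_aleph0, Cardinal.aleph0_lt_lift]
      exact hκ
    refine (hasCardinalLT_prod hκ.le hN hN).of_injective (fun f : Arrow ℕ => (f.left, f.right)) ?_
    rintro ⟨⟩ ⟨⟩ h
    simp only [Prod.mk.injEq] at h
    obtain ⟨h1, h2⟩ := h
    subst h1 h2
    congr 1
    exact Subsingleton.elim (α := (_ : ℕ) ⟶ _) _ _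
  · have h1 : F.map s.map ≫ coconeLeg d 1 = coconeLeg d 0 := by
      rw [← map_coconeLeg d (homOfLE (Nat.le_succ 0)), indexFunctor_map hn s 0]
      rfl
    rw [h1]
    exact S.cocone_colimitComul hd 0

end ComulApprox

end SweedlerTheory
namespace SweedlerTheory

open Limits

section CanonicalCocone

variable {C : Type u} [Category.{v} C] (P : ObjectProperty C) (X : C)

variable {P X} in
/-- A morphism to `X` from an object satisfying `P`, as an object over `X`. -/
def arrowMk {Y : C} (hY : P Y) (f : Y ⟶ X) : CostructuredArrow P.ι X :=
  CostructuredArrow.mk (S := P.ι) (Y := (⟨Y, hY⟩ : P.FullSubcategory)) f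

/-- The cocone of all morphisms to `X` from objects satisfying `P`. -/
def canonicalCocone : Cocone (CostructuredArrow.proj P.ι X ⋙ P.ι) :=
  ⟨X, { app j := j.hom
        naturality _ _ f := (CostructuredArrow.w f).trans (Category.comp_id _).symm }⟩

lemma nonempty_isColimit_canonicalCocone [P.ι.IsDense] :
    Nonempty (IsColimit (canonicalCocone P X)) :=
  ⟨IsColimit.ofIsoColimit (P.ι.denseAt X) (Cocone.ext (Iso.refl _)
    fun _ => (Category.comp_id _).trans (Category.id_comp _))⟩

lemma isDense_of_isColimit_canonicalCocone
    (h : ∀ X, Nonempty (IsColimit (canonicalCocone P X))) : P.ι.IsDense where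
  isDenseAt X := ⟨IsColimit.ofIsoColimit (h X).some (Cocone.ext (Iso.refl _)
    fun _ => (Category.comp_id _).trans (Category.id_comp _).symm)⟩

end CanonicalCocone

/-! ### Density of the presentable comonoids. -/

section PresentableComonoids

variable {V : Type u} [Category.{v} V] [MonoidalCategory.{v} V]

variable (V) in
/-- The comonoids whose underlying object is `κ`-presentable. -/
abbrev presentableComon (κ : Cardinal.{v}) [Fact κ.IsRegular] : ObjectProperty (Comon V) :=
  (isCardinalPresentable V κ).inverseImage (Comon.forget V)

variable (κ : Cardinal.{v}) [Fact κ.IsRegular] [IsCardinalLocallyPresentable V κ]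

/-- Presentable comonoids are closed under `κ`-small colimits, since these are computed in `V`; so
the category over `C` has such colimits. -/
instance (C : Comon V) : IsCardinalFiltered (CostructuredArrow (presentableComon V κ).ι C) κ where
  nonempty_cocone {J} _ K hJ := ⟨by
    have := isClosedUnderColimitsOfShape_isCardinalPresentable V hJ
    exact colimit.cocone K⟩

/-- The functor from presentable comonoids over a comonoid to presentable objects over the
underlying object. -/
def presentableComonForget (C : Comon V) :
    CostructuredArrow (presentableComon V κ).ι C ⥤
      CostructuredArrow (isCardinalPresentable V κ).ι C.X where
  obj K := arrowMk K.left.property K.hom.hom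
  map f := CostructuredArrow.homMk (ObjectProperty.homMk f.left.hom.hom)
    (congrArg Comon.Hom.hom (CostructuredArrow.w f))

variable [∀ X : V, PreservesColimits (tensorLeft X)] [∀ X : V, PreservesColimits (tensorRight X)]

/-- If a morphism between comonoids with presentable source factors through a presentable object,
then it factors through a presentable comonoid, compatibly. -/
lemma exists_comon_factorization (hκ : Cardinal.aleph0 < κ) {C D : Comon V} (f : D ⟶ C)
    (hD : IsCardinalPresentable D.X κ) {X : V} (hX : IsCardinalPresentable X κ)
    (p : D.X ⟶ X) (q : X ⟶ C.X) (w : p ≫ q = f.hom) :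
    ∃ (E : Comon V) (_ : IsCardinalPresentable E.X κ) (g : D ⟶ E) (h : E ⟶ C) (r : X ⟶ E.X),
      g ≫ h = f ∧ p ≫ r = g.hom ∧ r ≫ h.hom = q := by
  let c := canonicalCocone (isCardinalPresentable V κ) C.X
  obtain ⟨hc⟩ := nonempty_isColimit_canonicalCocone (isCardinalPresentable V κ) C.X
  have hF (j : CostructuredArrow (isCardinalPresentable V κ).ι C.X) : IsCardinalPresentable
      ((CostructuredArrow.proj (isCardinalPresentable V κ).ι C.X ⋙
        (isCardinalPresentable V κ).ι).obj j) κ := j.left.property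
  have hl (X : V) : PreservesColimitsOfShape
      (CostructuredArrow (isCardinalPresentable V κ).ι C.X) (tensorLeft X) :=
    preservesColimitsOfShape_of_equiv (equivSmallModel.{v} _).symm _
  have hr (X : V) : PreservesColimitsOfShape
      (CostructuredArrow (isCardinalPresentable V κ).ι C.X) (tensorRight X) :=
    preservesColimitsOfShape_of_equiv (equivSmallModel.{v} _).symm _
  let _ : ComonObj c.pt := C.comon
  -- Starting from the comultiplication of `D` followed by `p ⊗ p` forces `p ≫ r` to respect
  -- comultiplications in the end.
  let s : ComulApprox c :=
    { src := arrowMk hD f.hom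
      tgt := arrowMk hX q
      map := CostructuredArrow.homMk (ObjectProperty.homMk p) w
      comul := Δ[D.X] ≫ (p ⊗ₘ p)
      comul_coconeLeg := by
        change (Δ[D.X] ≫ (p ⊗ₘ p)) ≫ (q ⊗ₘ q) = f.hom ≫ Δ[C.X]
        rw [Category.assoc, tensorHom_comp_tensorHom, w, IsComonHom.hom_comul] }
  obtain ⟨E, hE, h, r, h1, h2⟩ := ComulApprox.exists_comon κ hκ hc s
  change E ⟶ C at h
  change X ⟶ E.X at r
  change r ≫ h.hom = q at h1
  change (p ≫ r) ≫ Δ[E.X] = (Δ[D.X] ≫ (p ⊗ₘ p)) ≫ (r ⊗ₘ r) at h2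
  have h3 : (p ≫ r) ≫ h.hom = f.hom := by rw [Category.assoc, h1, w]
  -- The counit is respected because `h` and `(p ≫ r) ≫ h = f` respect it.
  have : IsComonHom (p ≫ r) :=
    { hom_counit := by
        rw [← IsComonHom.hom_counit h.hom, ← Category.assoc, h3, IsComonHom.hom_counit]
      hom_comul := by rw [h2, Category.assoc, tensorHom_comp_tensorHom] }
  exact ⟨E, hE, Comon.Hom.mk (p ≫ r), h, r, Comon.ext h3, rfl, h1⟩

/-- Both categories are filtered, so finality only asks for maps into the image and for parallel
pairs to be equalized there. Both follow from `key`: a map out of the image can be continued to one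
that comes from comonoids. -/
lemma final_presentableComonForget (hκ : Cardinal.aleph0 < κ) (C : Comon V) :
    (presentableComonForget κ C).Final := by
  have := isFiltered_of_isCardinalFiltered (CostructuredArrow (presentableComon V κ).ι C) κ
  have := isFiltered_of_isCardinalFiltered
    (CostructuredArrow (isCardinalPresentable V κ).ι C.X) κ
  have key (K : CostructuredArrow (presentableComon V κ).ι C)
      (j : CostructuredArrow (isCardinalPresentable V κ).ι C.X)
      (t : (presentableComonForget κ C).obj K ⟶ j) :
      ∃ (L : CostructuredArrow (presentableComon V κ).ι C) (g : K ⟶ L)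
        (r : j ⟶ (presentableComonForget κ C).obj L),
        t ≫ r = (presentableComonForget κ C).map g := by
    obtain ⟨E, hE, g, h, r, h1, h2, h3⟩ := exists_comon_factorization κ hκ K.hom K.left.property
      j.left.property t.left.hom j.hom (CostructuredArrow.w t)
    refine ⟨arrowMk hE h,
      CostructuredArrow.homMk (ObjectProperty.homMk g) h1,
      CostructuredArrow.homMk (ObjectProperty.homMk r) h3, ?_⟩
    ext
    exact h2
  refine Functor.final_of_exists_of_isFiltered _ (fun j => ?_) (fun {j K} s s' => ?_)
  -- The choice of `K` is arbitrary; `key` is applied to an upper bound of its image and `j`.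
  · let K : CostructuredArrow (presentableComon V κ).ι C := IsFiltered.nonempty.some
    obtain ⟨L, -, r, -⟩ := key K (IsFiltered.max ((presentableComonForget κ C).obj K) j)
      (IsFiltered.leftToMax _ _)
    exact ⟨L, ⟨IsFiltered.rightToMax _ _ ≫ r⟩⟩
  · obtain ⟨L, g, r, h⟩ := key K _ (IsFiltered.coeqHom s s')
    exact ⟨L, g, by rw [← h, IsFiltered.coeq_condition_assoc]⟩

/-- Comonoids with presentable underlying object are dense, if the cardinal is uncountable. -/
lemma isDense_presentableComon (hκ : Cardinal.aleph0 < κ) : (presentableComon V κ).ι.IsDense := by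
  refine isDense_of_isColimit_canonicalCocone _ fun C => ?_
  have := final_presentableComonForget κ hκ C
  obtain ⟨hc⟩ := nonempty_isColimit_canonicalCocone (isCardinalPresentable V κ) C.X
  have hs : HasColimitsOfShape (CostructuredArrow (presentableComon V κ).ι C) V :=
    hasColimitsOfShape_of_equivalence (equivSmallModel.{v} _).symm
  -- Restriction along the final functor keeps the canonical cocone of `C.X` a colimit, and the
  -- forgetful functor reflects it.
  refine ⟨isColimitOfReflects (Comon.forget V) ?_⟩
  exact (Functor.Final.isColimitWhiskerEquiv (presentableComonForget κ C) _).symm hc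

end PresentableComonoids

/-! ### Existence of the universal measuring comonoids. -/

section Existence

variable (V : Type u) [Category.{v} V] [MonoidalCategory.{v} V] [MonoidalClosed V]
  [BraidedCategory V] [IsLocallyPresentable.{v} V]

instance isLeftAdjoint_convFunctor (B : Mon V) : (convFunctor B).IsLeftAdjoint := by
  obtain ⟨κ₀, _, _⟩ := IsLocallyPresentable.exists_cardinal.{v} V
  -- The successor is regular and uncountable, as density requires, and `V` is still locally
  -- presentable for it.
  let κ := Order.succ κ₀
  have hκ₀ : Cardinal.aleph0 ≤ κ₀ := (Fact.out : κ₀.IsRegular).aleph0_le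
  have : Fact κ.IsRegular := ⟨Cardinal.isRegular_succ hκ₀⟩
  have := IsCardinalLocallyPresentable.of_le V (Order.le_succ κ₀)
  have := isDense_presentableComon (V := V) κ (hκ₀.trans_lt (Order.lt_succ κ₀))
  have : HasColimits (Comon V) := ⟨inferInstance⟩
  have : PreservesColimits (convFunctor B) := ⟨inferInstance⟩
  exact isLeftAdjoint_of_isDense (presentableComon V κ) (convFunctor B)

lemma nonempty_sweedlerHom : Nonempty (SweedlerHom V) :=
  ⟨{ rightAdj B := (convFunctor B).rightAdjoint
     adj B := Adjunction.ofIsLeftAdjoint (convFunctor B) }⟩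

end Existence

end SweedlerTheory
namespace SweedlerTheory

/-! ### Measurings and their composition. -/

section Measuring

variable {V : Type u} [Category.{v} V] [MonoidalCategory.{v} V] [BraidedCategory V]

/-- Measurings from a monoid `A` to a monoid `B` by a comonoid `C`. -/
structure IsMeasuring {C A B : V} [ComonObj C] [MonObj A] [MonObj B] (φ : C ⊗ A ⟶ B) : Prop where
  one : C ◁ η[A] ≫ φ = (ρ_ C).hom ≫ ε[C] ≫ η[B]
  mul : C ◁ μ[A] ≫ φ = Δ[C] ▷ (A ⊗ A) ≫ tensorμ C C A A ≫ (φ ⊗ₘ φ) ≫ μ[B]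

/-- The convolution structure is defined by transposition, so the two axioms of a monoid morphism
transpose to those of a measuring. -/
lemma isMeasuring_uncurry_iff [MonoidalClosed V] (C : Comon V) (A B : Mon V)
    (f : A.X ⟶ (ihom C.X).obj B.X) :
    IsMeasuring (MonoidalClosed.uncurry f) ↔ IsMonHom (N := (convMon C B).X) f := by
  have one_iff : η[A.X] ≫ f = convOne C.X B.X ↔ C.X ◁ η[A.X] ≫ MonoidalClosed.uncurry f =
      (ρ_ C.X).hom ≫ ε[C.X] ≫ η[B.X] := by
    rw [← MonoidalClosed.uncurry_injective.eq_iff, MonoidalClosed.uncurry_natural_left,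
      uncurry_convOne]
  have mul_iff : μ[A.X] ≫ f = (f ⊗ₘ f) ≫ convMul C.X B.X ↔
      C.X ◁ μ[A.X] ≫ MonoidalClosed.uncurry f = Δ[C.X] ▷ (A.X ⊗ A.X) ≫ tensorμ C.X C.X A.X A.X ≫
        (MonoidalClosed.uncurry f ⊗ₘ MonoidalClosed.uncurry f) ≫ μ[B.X] := by
    rw [← MonoidalClosed.uncurry_injective.eq_iff, MonoidalClosed.uncurry_natural_left,
      uncurry_tensor_convMul]
  exact ⟨fun h => ⟨one_iff.mpr h.one, mul_iff.mpr h.mul⟩,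
    fun h => ⟨one_iff.mp h.one_hom, mul_iff.mp h.mul_hom⟩⟩

/-- The composition of measurings. -/
lemma IsMeasuring.comp {C D A B E : V} [ComonObj C] [ComonObj D] [MonObj A] [MonObj B] [MonObj E]
    {φ : D ⊗ A ⟶ B} {ψ : C ⊗ B ⟶ E} (hφ : IsMeasuring φ) (hψ : IsMeasuring ψ) :
    IsMeasuring ((α_ C D A).hom ≫ C ◁ φ ≫ ψ) where
  one := by
    have h : (C ⊗ D) ◁ η[A] ≫ (α_ C D A).hom = (α_ C D _).hom ≫ C ◁ D ◁ η[A] := by simp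
    rw [reassoc_of% h, ← MonoidalCategory.whiskerLeft_comp_assoc, hφ.one,
      MonoidalCategory.whiskerLeft_comp_assoc, MonoidalCategory.whiskerLeft_comp_assoc, hψ.one,
      Comon.tensorObj_counit, MonoidalCategory.tensorHom_def']
    simp [unitors_equal]
  mul := by
    have h : (C ⊗ D) ◁ μ[A] ≫ (α_ C D A).hom = (α_ C D _).hom ≫ C ◁ D ◁ μ[A] := by simp
    rw [reassoc_of% h, ← MonoidalCategory.whiskerLeft_comp_assoc, hφ.mul, Comon.tensorObj_comul]
    have h1 : ((α_ C D A).hom ≫ C ◁ φ ≫ ψ ⊗ₘ (α_ C D A).hom ≫ C ◁ φ ≫ ψ) =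
        ((α_ C D A).hom ⊗ₘ (α_ C D A).hom) ≫ (C ◁ φ ⊗ₘ C ◁ φ) ≫ (ψ ⊗ₘ ψ) := by
      simp only [tensorHom_comp_tensorHom]
    have h2 : (Δ[C] ⊗ₘ Δ[D]) ▷ (A ⊗ A) ≫ (α_ (C ⊗ C) (D ⊗ D) (A ⊗ A)).hom =
        (α_ _ _ _).hom ≫ (Δ[C] ⊗ₘ Δ[D] ▷ (A ⊗ A)) := by
      rw [← tensorHom_id, associator_naturality, tensorHom_id]
    rw [h1, comp_whiskerRight_assoc]
    simp only [Category.assoc]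
    -- Compatibility of `tensorμ` with associators separates the two actions; naturality and the
    -- multiplicativity of `ψ` do the rest.
    rw [tensor_associativity_assoc, reassoc_of% h2, ← tensorμ_natural_right_assoc,
      MonoidalCategory.tensorHom_def' φ, MonoidalCategory.tensorHom_def' Δ[C]]
    simp only [MonoidalCategory.whiskerLeft_comp, Category.assoc]
    rw [hψ.mul, whisker_exchange_assoc, whisker_exchange_assoc, whisker_exchange_assoc]

attribute [local instance] ComonObj.instTensorUnit in
/-- The measurings by the trivial comonoid are the morphisms of monoids. -/
lemma isMeasuring_leftUnitor_comp_iff {A B : V} [MonObj A] [MonObj B] (f : A ⟶ B) :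
    IsMeasuring ((λ_ A).hom ≫ f) ↔ IsMonHom f := by
  have one_iff : 𝟙_ V ◁ η[A] ≫ (λ_ A).hom ≫ f = (ρ_ (𝟙_ V)).hom ≫ ε[𝟙_ V] ≫ η[B] ↔
      η[A] ≫ f = η[B] := by
    simp [unitors_equal]
  have mul_iff : 𝟙_ V ◁ μ[A] ≫ (λ_ A).hom ≫ f = Δ[𝟙_ V] ▷ (A ⊗ A) ≫
      tensorμ (𝟙_ V) (𝟙_ V) A A ≫ ((λ_ A).hom ≫ f ⊗ₘ (λ_ A).hom ≫ f) ≫ μ[B] ↔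
      μ[A] ≫ f = (f ⊗ₘ f) ≫ μ[B] := by
    have h := tensor_left_unitality A A
    rw [ComonObj.instTensorUnit_comul, ← tensorHom_comp_tensorHom, Category.assoc,
      leftUnitor_naturality_assoc, ← reassoc_of% h, Iso.cancel_iso_hom_left]
  exact ⟨fun h => ⟨one_iff.mp h.one, mul_iff.mp h.mul⟩,
    fun h => ⟨one_iff.mpr h.one_hom, mul_iff.mpr h.mul_hom⟩⟩

end Measuring

end SweedlerTheory
namespace SweedlerTheory

/-! ### Interchange in a symmetric category and tensor products of measurings. -/

section ProductBraided

variable {V : Type u} [Category.{v} V] [MonoidalCategory.{v} V]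

/-- The componentwise braiding of a product of braided categories. -/
@[reducible]
def prodBraided [BraidedCategory V] : BraidedCategory (V × V) where
  braiding X Y := Iso.prod (β_ X.1 Y.1) (β_ X.2 Y.2)
  braiding_naturality_right X _ _ f := Prod.ext
    (BraidedCategory.braiding_naturality_right X.1 f.1)
    (BraidedCategory.braiding_naturality_right X.2 f.2)
  braiding_naturality_left f Z := Prod.ext
    (BraidedCategory.braiding_naturality_left f.1 Z.1)
    (BraidedCategory.braiding_naturality_left f.2 Z.2)
  hexagon_forward X Y Z := Prod.ext
    (BraidedCategory.hexagon_forward X.1 Y.1 Z.1) (BraidedCategory.hexagon_forward X.2 Y.2 Z.2)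
  hexagon_reverse X Y Z := Prod.ext
    (BraidedCategory.hexagon_reverse X.1 Y.1 Z.1) (BraidedCategory.hexagon_reverse X.2 Y.2 Z.2)

variable [SymmetricCategory V]

/-- The crossing of `X` and `Y` in `tensorμ` is undone by the one in the large braiding; this needs
the symmetry. -/
lemma tensorμ_comp_braiding_interchange (W X Y Z : V) :
    tensorμ W X Y Z ≫ (β_ (W ⊗ Y) (X ⊗ Z)).hom =
      ((β_ W X).hom ⊗ₘ (β_ Y Z).hom) ≫ tensorμ X W Z Y := by
  simp only [tensorμ, Category.assoc, BraidedCategory.braiding_tensor_right_hom,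
    BraidedCategory.braiding_tensor_left_hom, comp_whiskerRight, whisker_assoc,
    MonoidalCategory.whiskerLeft_comp, pentagon_assoc, pentagon_inv_hom_hom_hom_inv_assoc,
    Iso.inv_hom_id_assoc, whiskerLeft_hom_inv_assoc]
  slice_lhs 3 4 =>
    rw [← MonoidalCategory.whiskerLeft_comp, ← comp_whiskerRight, SymmetricCategory.symmetry]
  simp only [id_whiskerRight, MonoidalCategory.whiskerLeft_id, Category.id_comp, Category.assoc,
    pentagon_inv_assoc, Iso.hom_inv_id_assoc]
  slice_lhs 1 2 =>
    rw [← associator_inv_naturality_left]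
  slice_lhs 2 3 =>
    rw [Iso.inv_hom_id]
  rw [Category.id_comp]
  slice_lhs 2 3 =>
    rw [← associator_naturality_right]
  slice_lhs 1 2 =>
    rw [← MonoidalCategory.tensorHom_def]
  simp only [Category.assoc]

/-- The previous identity, conjugated by the involutive `tensorμ`. It says that the tensor product
functor is braided. -/
lemma tensorμ_comp_tensorHom_braiding (W X Y Z : V) :
    tensorμ W X Y Z ≫ ((β_ W Y).hom ⊗ₘ (β_ X Z).hom) =
      (β_ (W ⊗ X) (Y ⊗ Z)).hom ≫ tensorμ Y Z W X := by
  have h := congrArg (fun t => tensorμ W X Y Z ≫ t ≫ tensorμ Y Z W X)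
    (tensorμ_comp_braiding_interchange W Y X Z)
  simp only [Category.assoc, tensorμ_tensorμ, Category.comp_id] at h
  rw [← h, ← Category.assoc, tensorμ_tensorμ, Category.id_comp]

/-- The interchange of eight factors. -/
lemma tensorμ_interchange (W₁ W₂ X₁ X₂ Y₁ Y₂ Z₁ Z₂ : V) :
    tensorμ (W₁ ⊗ W₂) (X₁ ⊗ X₂) (Y₁ ⊗ Y₂) (Z₁ ⊗ Z₂) ≫
        (tensorμ W₁ W₂ Y₁ Y₂ ⊗ₘ tensorμ X₁ X₂ Z₁ Z₂) ≫
          tensorμ (W₁ ⊗ Y₁) (W₂ ⊗ Y₂) (X₁ ⊗ Z₁) (X₂ ⊗ Z₂) =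
      (tensorμ W₁ W₂ X₁ X₂ ⊗ₘ tensorμ Y₁ Y₂ Z₁ Z₂) ≫
        tensorμ (W₁ ⊗ X₁) (W₂ ⊗ X₂) (Y₁ ⊗ Z₁) (Y₂ ⊗ Z₂) ≫
          (tensorμ W₁ X₁ Y₁ Z₁ ⊗ₘ tensorμ W₂ X₂ Y₂ Z₂) := by
  let _ : BraidedCategory (V × V) := prodBraided
  -- The eight-factor identity is the compatibility of a lax braided functor with `tensorμ`, for the
  -- tensor product functor on `V × V`.
  let _ : (tensor V).LaxBraided :=
    { braided X Y := (tensorμ_comp_tensorHom_braiding X.1 X.2 Y.1 Y.2) }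
  exact MonoidalCategory.tensorμ_comp_μ_tensorHom_μ_comp_μ (tensor V)
    (W₁, W₂) (X₁, X₂) (Y₁, Y₂) (Z₁, Z₂)

/-- The tensor product of measurings. -/
lemma IsMeasuring.tensor {C D A B A' B' : V} [ComonObj C] [ComonObj D] [MonObj A] [MonObj B]
    [MonObj A'] [MonObj B'] {φ : C ⊗ A ⟶ A'} {ψ : D ⊗ B ⟶ B'}
    (hφ : IsMeasuring φ) (hψ : IsMeasuring ψ) :
    IsMeasuring (tensorμ C D A B ≫ (φ ⊗ₘ ψ)) where
  one := by
    rw [MonObj.tensorObj.one_def, MonoidalCategory.whiskerLeft_comp, Category.assoc,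
      tensorμ_natural_right_assoc, tensorHom_comp_tensorHom, hφ.one, hψ.one,
      ← tensorHom_comp_tensorHom, ← tensorHom_comp_tensorHom, Comon.tensorObj_counit]
    rw [← reassoc_of% tensor_right_unitality C D, MonObj.tensorObj.one_def,
      MonoidalCategory.tensorHom_def_assoc]
    simp [MonoidalCategory.tensorHom_def]
  mul := by
    rw [MonObj.tensorObj.mul_def, MonObj.tensorObj.mul_def, MonoidalCategory.whiskerLeft_comp,
      Category.assoc, tensorμ_natural_right_assoc, tensorHom_comp_tensorHom, hφ.mul, hψ.mul,
      Comon.tensorObj_comul, ← tensorHom_comp_tensorHom, ← tensorHom_comp_tensorHom,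
      ← tensorHom_comp_tensorHom, ← tensorHom_comp_tensorHom, ← tensorμ_natural_left_assoc]
    -- The `tensorμ C C D D` in the comultiplication of `C ⊗ D` cancels the `tensorμ C D C D` that
    -- the interchange produces.
    rw [comp_whiskerRight_assoc, Category.assoc, tensorμ_natural_assoc,
      reassoc_of% tensorμ_interchange, MonoidalCategory.tensorHom_def (tensorμ C D C D),
      Category.assoc,
      ← comp_whiskerRight_assoc (tensorμ C C D D), tensorμ_tensorμ, id_whiskerRight,
      Category.id_comp, whisker_exchange_assoc]

end ProductBraided

end SweedlerTheory
namespace SweedlerTheory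

namespace SweedlerHom

/-! ### The universal property of `P(A, B)` in terms of measurings. -/

section Act

variable {V : Type u} [Category.{v} V] [MonoidalCategory.{v} V] [MonoidalClosed V]
  [BraidedCategory V] (S : SweedlerHom V)

/-- The action `X ⊗ A ⟶ B` that corresponds to a morphism `X ⟶ P(A, B)`. -/
def act {X : V} {A B : Mon V} (h : X ⟶ (S.P A B).X) : X ⊗ A.X ⟶ B.X :=
  h ▷ A.X ≫ S.ev A B

variable {A B : Mon V}

/-- The morphism of monoids `A ⟶ [C, B]` that corresponds to `h : C ⟶ P(A, B)`. -/
def transpose {C : Comon V} (h : C ⟶ S.P A B) : A ⟶ convMon C B :=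
  (((S.adj B).homEquiv C (op A)).symm h).unop

lemma transpose_injective (C : Comon V) (A B : Mon V) :
    Function.Injective (S.transpose (C := C) (A := A) (B := B)) := fun _ _ e =>
  ((S.adj B).homEquiv C (op A)).symm.injective (Quiver.Hom.unop_inj e)

lemma transpose_surjective (C : Comon V) (A B : Mon V) :
    Function.Surjective (S.transpose (C := C) (A := A) (B := B)) := fun f =>
  ⟨(S.adj B).homEquiv C (op A) f.op,
    congrArg Quiver.Hom.unop (((S.adj B).homEquiv C (op A)).symm_apply_apply f.op)⟩

/-- The morphism of `V` that underlies the transpose of `h : C ⟶ P(A, B)`. -/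
def transposeHom {C : Comon V} (h : C ⟶ S.P A B) : A.X ⟶ (ihom C.X).obj B.X :=
  (S.transpose h).hom

/-- The adjunction sends `h` to the counit followed by `[h, B]`, whose transpose is the universal
measuring precomposed with `h`. -/
lemma uncurry_transposeHom {C : Comon V} (h : C ⟶ S.P A B) :
    MonoidalClosed.uncurry (S.transposeHom h) = S.act h.hom := by
  have e : S.transposeHom h =
      ((S.adj B).counit.app (op A)).unop.hom ≫ (MonoidalClosed.pre h.hom).app B.X :=
    congrArg (fun t => t.unop.hom) ((S.adj B).homEquiv_counit (X := C) (Y := op A) (g := h))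
  rw [e]
  exact MonoidalClosed.uncurry_pre_app (C := V) (Y := A.X) (X := B.X)
    ((S.adj B).counit.app (op A)).unop.hom h.hom

lemma isMeasuring_act {C : Comon V} (h : C ⟶ S.P A B) : IsMeasuring (S.act h.hom) := by
  rw [← uncurry_transposeHom]
  exact (isMeasuring_uncurry_iff C A B _).mpr (S.transpose h).isMonHom_hom

/-- The main tool for the axioms: it reduces equations in `Comon V` to equations between actions in
`V`. -/
lemma hom_ext {C : Comon V} {h k : C ⟶ S.P A B} (e : S.act h.hom = S.act k.hom) : h = k := by
  rw [← uncurry_transposeHom, ← uncurry_transposeHom] at e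
  exact S.transpose_injective C A B (Mon.Hom.ext (MonoidalClosed.uncurry_injective e))

lemma exists_act_eq (C : Comon V) {φ : C.X ⊗ A.X ⟶ B.X} (hφ : IsMeasuring φ) :
    ∃ h : C ⟶ S.P A B, S.act h.hom = φ := by
  have hm : IsMonHom (N := (convMon C B).X) (MonoidalClosed.curry φ) :=
    (isMeasuring_uncurry_iff C A B _).mp (by rwa [MonoidalClosed.uncurry_curry])
  obtain ⟨h, hh⟩ := S.transpose_surjective C A B (Mon.Hom.mk (MonoidalClosed.curry φ))
  refine ⟨h, ?_⟩
  have e : S.transposeHom h = MonoidalClosed.curry φ := congrArg Mon.Hom.hom hh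
  rw [← uncurry_transposeHom, e]
  exact MonoidalClosed.uncurry_curry φ

/-- The morphism of comonoids into `P(A, B)` that corresponds to a measuring. -/
noncomputable def lift (C : Comon V) {φ : C.X ⊗ A.X ⟶ B.X} (hφ : IsMeasuring φ) : C ⟶ S.P A B :=
  (S.exists_act_eq C hφ).choose

lemma act_lift (C : Comon V) {φ : C.X ⊗ A.X ⟶ B.X} (hφ : IsMeasuring φ) :
    S.act (S.lift C hφ).hom = φ :=
  (S.exists_act_eq C hφ).choose_spec

lemma act_comp {X Y : V} (g : Y ⟶ X) (h : X ⟶ (S.P A B).X) :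
    S.act (g ≫ h) = g ▷ A.X ≫ S.act h := by
  simp [act]

lemma act_id (A B : Mon V) : S.act (𝟙 (S.P A B).X) = S.ev A B := by
  simp [act]

lemma isMeasuring_ev (A B : Mon V) : IsMeasuring (S.ev A B) := by
  rw [← act_id]
  exact S.isMeasuring_act (𝟙 (S.P A B))

/-- The composition `P(B, C) ⊗ P(A, B) ⟶ P(A, C)`. -/
noncomputable def comp (A B C : Mon V) : S.P B C ⊗ S.P A B ⟶ S.P A C :=
  S.lift (S.P B C ⊗ S.P A B)
    (φ := (α_ (S.P B C).X (S.P A B).X A.X).hom ≫ (S.P B C).X ◁ S.ev A B ≫ S.ev B C)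
    ((S.isMeasuring_ev A B).comp (S.isMeasuring_ev B C))

/-- The morphism of `V` that underlies the composition `P(B, C) ⊗ P(A, B) ⟶ P(A, C)`. -/
noncomputable def compHom (A B C : Mon V) : (S.P B C).X ⊗ (S.P A B).X ⟶ (S.P A C).X :=
  (S.comp A B C).hom

lemma act_compHom (A B C : Mon V) :
    S.act (S.compHom A B C) =
      (α_ (S.P B C).X (S.P A B).X A.X).hom ≫ (S.P B C).X ◁ S.ev A B ≫ S.ev B C :=
  S.act_lift (S.P B C ⊗ S.P A B) _

/-- Formulated for arbitrary morphisms of `V` into the hom-objects, so that iterated composites can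
be evaluated by rewriting. -/
lemma act_tensorHom_comp {X Y : V} {A B C : Mon V} (h : X ⟶ (S.P B C).X) (k : Y ⟶ (S.P A B).X) :
    S.act ((h ⊗ₘ k) ≫ S.compHom A B C) = (α_ X Y A.X).hom ≫ X ◁ S.act k ≫ S.act h := by
  rw [act_comp, act_compHom, ← tensorHom_id, associator_naturality_assoc, tensorHom_id, act, act,
    MonoidalCategory.whiskerLeft_comp_assoc, whisker_exchange_assoc,
    MonoidalCategory.tensorHom_def'_assoc]

/-- The element of `P(A, B)` that corresponds to a morphism of monoids. -/
noncomputable def element (f : A ⟶ B) : 𝟙_ (Comon V) ⟶ S.P A B :=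
  S.lift (𝟙_ (Comon V)) ((isMeasuring_leftUnitor_comp_iff f.hom).mpr f.isMonHom_hom)

/-- The morphism of `V` that underlies the element of `P(A, B)` corresponding to a morphism of
monoids. -/
noncomputable def elementHom (f : A ⟶ B) : 𝟙_ V ⟶ (S.P A B).X :=
  (S.element f).hom

lemma act_elementHom (f : A ⟶ B) : S.act (S.elementHom f) = (λ_ A.X).hom ≫ f.hom :=
  S.act_lift _ _

/-- The morphism of monoids that corresponds to an element of `P(A, B)`. -/
def ofElement (h : 𝟙_ (Comon V) ⟶ S.P A B) : A ⟶ B where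
  hom := (λ_ A.X).inv ≫ S.act (X := 𝟙_ V) h.hom
  isMonHom_hom := by
    rw [← isMeasuring_leftUnitor_comp_iff, Iso.hom_inv_id_assoc]
    exact S.isMeasuring_act h

/-- The elements of `P(A, B)` are the morphisms of monoids. -/
noncomputable def elementEquiv (A B : Mon V) : (A ⟶ B) ≃ (𝟙_ (Comon V) ⟶ S.P A B) where
  toFun := S.element
  invFun := S.ofElement
  left_inv f := by
    ext
    change (λ_ A.X).inv ≫ S.act (S.elementHom f) = f.hom
    rw [act_elementHom, Iso.inv_hom_id_assoc]
  right_inv h := by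
    apply S.hom_ext
    refine (S.act_elementHom _).trans ?_
    exact Iso.hom_inv_id_assoc _ _

end Act

end SweedlerHom

end SweedlerTheory
namespace SweedlerTheory

/-! ### Underlying morphisms of the structure isomorphisms of comonoids. -/

section ComonStructure

variable {V : Type u} [Category.{v} V] [MonoidalCategory.{v} V]

section

variable [BraidedCategory V]

lemma comon_leftUnitor_inv (A : Comon V) : Comon.Hom.hom (λ_ A).inv = (λ_ A.X).inv := by
  rw [Comon.monoidal_leftUnitor_inv_hom]
  change _ ≫ (𝟙 (𝟙_ V)) ▷ A.X = _
  simp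

lemma comon_rightUnitor_inv (A : Comon V) : Comon.Hom.hom (ρ_ A).inv = (ρ_ A.X).inv := by
  rw [Comon.monoidal_rightUnitor_inv_hom]
  change _ ≫ A.X ◁ (𝟙 (𝟙_ V)) = _
  simp

lemma comon_associator_hom (A B C : Comon V) :
    Comon.Hom.hom (α_ A B C).hom = (α_ A.X B.X C.X).hom := by
  rw [Comon.monoidal_associator_hom_hom]
  change (𝟙 (A.X ⊗ B.X)) ▷ C.X ≫ _ ≫ A.X ◁ (𝟙 (B.X ⊗ C.X)) = _
  simp

lemma comon_associator_inv (A B C : Comon V) :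
    Comon.Hom.hom (α_ A B C).inv = (α_ A.X B.X C.X).inv := by
  rw [Comon.monoidal_associator_inv_hom]
  change A.X ◁ (𝟙 (B.X ⊗ C.X)) ≫ _ ≫ (𝟙 (A.X ⊗ B.X)) ▷ C.X = _
  simp

end

lemma comon_tensorμ [SymmetricCategory V] (A B C D : Comon V) :
    Comon.Hom.hom (tensorμ A B C D) = tensorμ A.X B.X C.X D.X := by
  change Comon.Hom.hom (α_ A B (C ⊗ D)).hom ≫ A.X ◁ Comon.Hom.hom (α_ B C D).inv ≫
    A.X ◁ (β_ B.X C.X).hom ▷ D.X ≫ A.X ◁ Comon.Hom.hom (α_ C B D).hom ≫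
    Comon.Hom.hom (α_ A C (B ⊗ D)).inv = _
  rw [comon_associator_hom, comon_associator_hom, comon_associator_inv, comon_associator_inv]
  rfl

end ComonStructure

namespace SweedlerHom

/-! ### The enrichment of `Mon(V)ᵒᵖ`. -/

section OpEnrichment

variable {V : Type u} [Category.{v} V] [MonoidalCategory.{v} V] [MonoidalClosed V]
  [BraidedCategory V] (S : SweedlerHom V)

/-- The morphism of `V` that underlies the precomposition `P(B, C) ⟶ P(A, C)` with a morphism
of monoids. -/
noncomputable def preHom {A B : Mon V} (f : A ⟶ B) (C : Mon V) : (S.P B C).X ⟶ (S.P A C).X :=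
  (ρ_ _).inv ≫ _ ◁ S.elementHom f ≫ S.compHom A B C

/-- The morphism of `V` that underlies the postcomposition `P(A, B) ⟶ P(A, C)` with a morphism
of monoids. -/
noncomputable def postHom (A : Mon V) {B C : Mon V} (g : B ⟶ C) : (S.P A B).X ⟶ (S.P A C).X :=
  (λ_ _).inv ≫ S.elementHom g ▷ _ ≫ S.compHom A B C

lemma act_comp_preHom {X : V} {A B C : Mon V} (h : X ⟶ (S.P B C).X) (f : A ⟶ B) :
    S.act (h ≫ S.preHom f C) = X ◁ f.hom ≫ S.act h := by
  rw [act_comp, preHom, act_comp, ← id_tensorHom, act_tensorHom_comp, act_elementHom, act_id, act,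
    MonoidalCategory.whiskerLeft_comp_assoc, whisker_exchange_assoc]
  simp

lemma act_comp_postHom {X : V} {A B C : Mon V} (h : X ⟶ (S.P A B).X) (g : B ⟶ C) :
    S.act (h ≫ S.postHom A g) = S.act h ≫ g.hom := by
  rw [act_comp, postHom, act_comp, ← tensorHom_id (S.elementHom g), act_tensorHom_comp,
    act_elementHom, act_id, act]
  simp

/-- The precomposition `P(B, C) ⟶ P(A, C)` with a morphism of monoids. -/
noncomputable def pre {A B : Mon V} (f : A ⟶ B) (C : Mon V) : S.P B C ⟶ S.P A C :=
  (ρ_ _).inv ≫ _ ◁ S.element f ≫ S.comp A B C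

/-- The postcomposition `P(A, B) ⟶ P(A, C)` with a morphism of monoids. -/
noncomputable def post (A : Mon V) {B C : Mon V} (g : B ⟶ C) : S.P A B ⟶ S.P A C :=
  (λ_ _).inv ≫ S.element g ▷ _ ≫ S.comp A B C

lemma pre_hom {A B : Mon V} (f : A ⟶ B) (C : Mon V) : (S.pre f C).hom = S.preHom f C := by
  change Comon.Hom.hom (ρ_ (S.P B C)).inv ≫ (S.P B C).X ◁ S.elementHom f ≫ S.compHom A B C = _
  rw [comon_rightUnitor_inv]
  rfl

lemma post_hom (A : Mon V) {B C : Mon V} (g : B ⟶ C) : (S.post A g).hom = S.postHom A g := by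
  change Comon.Hom.hom (λ_ (S.P A B)).inv ≫ S.elementHom g ▷ (S.P A B).X ≫ S.compHom A B C = _
  rw [comon_leftUnitor_inv]
  rfl

/-- This and `pre_id` are the unit laws of the enrichment: the element of an identity acts
trivially. -/
lemma post_id (A B : Mon V) :
    S.post A (𝟙 B) = 𝟙 (S.P A B) := by
  apply S.hom_ext
  rw [post_hom]
  change S.act (S.postHom A (𝟙 B)) = S.act (𝟙 (S.P A B).X)
  rw [← Category.id_comp (S.postHom A (𝟙 B)), act_comp_postHom]
  exact Category.comp_id _

lemma pre_id (A B : Mon V) :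
    S.pre (𝟙 A) B = 𝟙 (S.P A B) := by
  apply S.hom_ext
  rw [pre_hom]
  change S.act (S.preHom (𝟙 A) B) = S.act (𝟙 (S.P A B).X)
  rw [← Category.id_comp (S.preHom (𝟙 A) B), act_comp_preHom, Mon.id_hom',
    MonoidalCategory.whiskerLeft_id, Category.id_comp]

/-- Both sides act as the threefold composite of universal measurings. -/
lemma comp_assoc (A B C D : Mon V) :
    (α_ (S.P C D) (S.P B C) (S.P A B)).inv ≫ S.comp B C D ▷ S.P A B ≫ S.comp A B D =
      S.P C D ◁ S.comp A B C ≫ S.comp A C D := by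
  apply S.hom_ext
  change S.act (Comon.Hom.hom (α_ (S.P C D) (S.P B C) (S.P A B)).inv ≫
    S.compHom B C D ▷ (S.P A B).X ≫ S.compHom A B D) =
      S.act ((S.P C D).X ◁ S.compHom A B C ≫ S.compHom A C D)
  rw [comon_associator_inv]
  change S.act ((α_ (S.P C D).X (S.P B C).X (S.P A B).X).inv ≫ S.compHom B C D ▷ (S.P A B).X ≫
    S.compHom A B D) = _
  rw [S.act_comp (α_ (S.P C D).X (S.P B C).X (S.P A B).X).inv, ← tensorHom_id (S.compHom B C D),
    ← id_tensorHom, act_tensorHom_comp, act_tensorHom_comp, act_compHom, act_compHom, act_id,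
    act_id]
  simp

lemma element_comp {A B C : Mon V} (f : A ⟶ B) (g : B ⟶ C) :
    S.element (f ≫ g) = (λ_ _).inv ≫ (S.element g ⊗ₘ S.element f) ≫ S.comp A B C := by
  apply S.hom_ext
  change S.act (S.elementHom (f ≫ g)) = S.act (Comon.Hom.hom (λ_ (𝟙_ (Comon V))).inv ≫
    (S.elementHom g ⊗ₘ S.elementHom f) ≫ S.compHom A B C)
  rw [comon_leftUnitor_inv]
  change _ = S.act ((λ_ (𝟙_ V)).inv ≫ (S.elementHom g ⊗ₘ S.elementHom f) ≫ S.compHom A B C)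
  rw [act_elementHom, act_comp, act_tensorHom_comp, act_elementHom, act_elementHom]
  simp

/-- The enrichment of `Mon(V)ᵒᵖ` in `Comon(V)` with hom-objects `Mon(V)ᵒᵖ(A, B) = P(B, A)`. -/
@[reducible]
noncomputable def opEnrichment : EnrichedOrdinaryCategory (Comon V) (Mon V)ᵒᵖ where
  Hom X Y := S.P Y.unop X.unop
  id X := S.element (𝟙 X.unop)
  -- Reversing the variables puts the factors in the order `P(Y, X) ⊗ P(Z, Y)`, so no braiding is
  -- inserted.
  comp X Y Z := S.comp Z.unop Y.unop X.unop
  id_comp X Y := S.post_id Y.unop X.unop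
  comp_id X Y := S.pre_id Y.unop X.unop
  assoc W X Y Z := S.comp_assoc Z.unop Y.unop X.unop W.unop
  homEquiv {X Y} := (opEquiv X Y).trans (S.elementEquiv Y.unop X.unop)
  homEquiv_id _ := rfl
  homEquiv_comp f g := S.element_comp g.unop f.unop

lemma isOpEnrichment_opEnrichment : S.IsOpEnrichment S.opEnrichment where
  -- The comparison morphisms in the other fields are therefore identities.
  hom_eq _ _ := rfl
  homEquiv_ev {A B} f := by
    change (λ_ A.X).inv ≫ S.act (S.elementHom f ≫ 𝟙 _) = f.hom
    rw [Category.comp_id, act_elementHom, Iso.inv_hom_id_assoc]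
  comp_ev A B C := by
    change S.act (S.compHom A B C ≫ 𝟙 _) = (𝟙 (S.P B C).X ⊗ₘ 𝟙 (S.P A B).X) ▷ A.X ≫ _
    rw [Category.comp_id, act_compHom]
    simp

end OpEnrichment

end SweedlerHom

end SweedlerTheory
namespace SweedlerTheory

namespace SweedlerHom

/-! ### The tensor product of hom-objects. -/

section Tensor

variable {V : Type u} [Category.{v} V] [MonoidalCategory.{v} V] [MonoidalClosed V]
  [SymmetricCategory V] (S : SweedlerHom V)

/-- The tensor product of hom-objects `P(A, C) ⊗ P(B, D) ⟶ P(A ⊗ B, C ⊗ D)`. -/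
noncomputable def tens (A B C D : Mon V) : S.P A C ⊗ S.P B D ⟶ S.P (A ⊗ B) (C ⊗ D) :=
  S.lift (S.P A C ⊗ S.P B D)
    (φ := tensorμ (S.P A C).X (S.P B D).X A.X B.X ≫ (S.ev A C ⊗ₘ S.ev B D))
    ((S.isMeasuring_ev A C).tensor (S.isMeasuring_ev B D))

/-- The morphism of `V` that underlies the tensor product of hom-objects. -/
noncomputable def tensHom (A B C D : Mon V) :
    (S.P A C).X ⊗ (S.P B D).X ⟶ (S.P (A ⊗ B) (C ⊗ D)).X :=
  (S.tens A B C D).hom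

lemma act_tensHom (A B C D : Mon V) : S.act (S.tensHom A B C D) =
    tensorμ (S.P A C).X (S.P B D).X A.X B.X ≫ (S.ev A C ⊗ₘ S.ev B D) :=
  S.act_lift (S.P A C ⊗ S.P B D) _

lemma act_tensorHom_tensHom {X Y : V} {A B C D : Mon V} (h : X ⟶ (S.P A C).X)
    (k : Y ⟶ (S.P B D).X) :
    S.act ((h ⊗ₘ k) ≫ S.tensHom A B C D) =
      tensorμ X Y A.X B.X ≫ (S.act h ⊗ₘ S.act k) := by
  rw [act_comp, act_tensHom, act, act, ← tensorHom_comp_tensorHom]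
  exact tensorμ_natural_left_assoc h k A.X B.X _

lemma tens_element {A B C D : Mon V} (f : A ⟶ C) (g : B ⟶ D) :
    (λ_ _).inv ≫ (S.element f ⊗ₘ S.element g) ≫ S.tens A B C D = S.element (f ⊗ₘ g) := by
  apply S.hom_ext
  change S.act (Comon.Hom.hom (λ_ (𝟙_ (Comon V))).inv ≫ (S.elementHom f ⊗ₘ S.elementHom g) ≫
    S.tensHom A B C D) = S.act (S.elementHom (f ⊗ₘ g))
  rw [comon_leftUnitor_inv]
  change S.act ((λ_ (𝟙_ V)).inv ≫ (S.elementHom f ⊗ₘ S.elementHom g) ≫ S.tensHom A B C D) = _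
  rw [act_elementHom, act_comp, act_tensorHom_tensHom, act_elementHom, act_elementHom,
    ← tensorHom_comp_tensorHom]
  exact (tensor_left_unitality_assoc A.X B.X (f.hom ⊗ₘ g.hom)).symm

/-- Evaluated on actions, both sides apply the two composite measurings side by side, up to an
interchange governed by `tensor_associativity`. -/
lemma tens_comp (A₁ A₂ B₁ B₂ C₁ C₂ : Mon V) :
    (S.tens B₁ B₂ C₁ C₂ ⊗ₘ S.tens A₁ A₂ B₁ B₂) ≫ S.comp (A₁ ⊗ A₂) (B₁ ⊗ B₂) (C₁ ⊗ C₂) =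
      tensorμ _ _ _ _ ≫ (S.comp A₁ B₁ C₁ ⊗ₘ S.comp A₂ B₂ C₂) ≫ S.tens A₁ A₂ C₁ C₂ := by
  apply S.hom_ext
  change S.act ((S.tensHom B₁ B₂ C₁ C₂ ⊗ₘ S.tensHom A₁ A₂ B₁ B₂) ≫
    S.compHom (A₁ ⊗ A₂) (B₁ ⊗ B₂) (C₁ ⊗ C₂)) =
      S.act (Comon.Hom.hom (tensorμ (S.P B₁ C₁) (S.P B₂ C₂) (S.P A₁ B₁) (S.P A₂ B₂)) ≫
        (S.compHom A₁ B₁ C₁ ⊗ₘ S.compHom A₂ B₂ C₂) ≫ S.tensHom A₁ A₂ C₁ C₂)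
  rw [comon_tensorμ]
  change _ = S.act (tensorμ (S.P B₁ C₁).X (S.P B₂ C₂).X (S.P A₁ B₁).X (S.P A₂ B₂).X ≫
    (S.compHom A₁ B₁ C₁ ⊗ₘ S.compHom A₂ B₂ C₂) ≫ S.tensHom A₁ A₂ C₁ C₂)
  rw [act_tensorHom_comp, act_comp, act_tensorHom_tensHom, act_tensHom, act_tensHom, act_compHom,
    act_compHom]
  -- With arbitrary morphisms in place of the universal measurings, only coherence and naturality in
  -- `V` remain.
  have h {e₁ : (S.P A₁ B₁).X ⊗ A₁.X ⟶ B₁.X} {e₂ : (S.P A₂ B₂).X ⊗ A₂.X ⟶ B₂.X}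
      {k₁ : (S.P B₁ C₁).X ⊗ B₁.X ⟶ C₁.X} {k₂ : (S.P B₂ C₂).X ⊗ B₂.X ⟶ C₂.X} :
      (α_ _ _ _).hom ≫ _ ◁ (tensorμ _ _ _ _ ≫ (e₁ ⊗ₘ e₂)) ≫ tensorμ _ _ _ _ ≫ (k₁ ⊗ₘ k₂) =
        tensorμ _ _ _ _ ▷ _ ≫ tensorμ _ _ _ _ ≫
          ((α_ _ _ _).hom ≫ _ ◁ e₁ ≫ k₁ ⊗ₘ (α_ _ _ _).hom ≫ _ ◁ e₂ ≫ k₂) := by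
    rw [← tensorHom_comp_tensorHom, tensor_associativity_assoc, ← tensorHom_comp_tensorHom,
      MonoidalCategory.whiskerLeft_comp_assoc, tensorμ_natural_right_assoc]
  exact h

lemma act_tensHom_associator {A₁ A₂ A₃ B₁ B₂ B₃ : Mon V} :
    S.act (S.tensHom A₁ A₂ B₁ B₂ ▷ (S.P A₃ B₃).X ≫ S.tensHom (A₁ ⊗ A₂) A₃ (B₁ ⊗ B₂) B₃) ≫
        (α_ B₁.X B₂.X B₃.X).hom =
      ((α_ _ _ _).hom ⊗ₘ (α_ A₁.X A₂.X A₃.X).hom) ≫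
        S.act ((S.P A₁ B₁).X ◁ S.tensHom A₂ A₃ B₂ B₃ ≫
          S.tensHom A₁ (A₂ ⊗ A₃) B₁ (B₂ ⊗ B₃)) := by
  rw [← tensorHom_id, ← id_tensorHom, act_tensorHom_tensHom, act_tensorHom_tensHom, act_tensHom,
    act_tensHom, act_id, act_id]
  have h {e₁ : (S.P A₁ B₁).X ⊗ A₁.X ⟶ B₁.X} {e₂ : (S.P A₂ B₂).X ⊗ A₂.X ⟶ B₂.X}
      {e₃ : (S.P A₃ B₃).X ⊗ A₃.X ⟶ B₃.X} :
      (tensorμ _ _ _ _ ≫ (tensorμ _ _ _ _ ≫ (e₁ ⊗ₘ e₂) ⊗ₘ e₃)) ≫ (α_ _ _ _).hom =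
        ((α_ _ _ _).hom ⊗ₘ (α_ _ _ _).hom) ≫ tensorμ _ _ _ _ ≫
          (e₁ ⊗ₘ tensorμ _ _ _ _ ≫ (e₂ ⊗ₘ e₃)) := by
    have h1 : (tensorμ (S.P A₁ B₁).X (S.P A₂ B₂).X A₁.X A₂.X ≫ (e₁ ⊗ₘ e₂) ⊗ₘ e₃) =
      tensorμ _ _ _ _ ▷ _ ≫ ((e₁ ⊗ₘ e₂) ⊗ₘ e₃) := by
        rw [← tensorHom_id, tensorHom_comp_tensorHom, Category.id_comp]
    have h2 : (e₁ ⊗ₘ tensorμ (S.P A₂ B₂).X (S.P A₃ B₃).X A₂.X A₃.X ≫ (e₂ ⊗ₘ e₃)) =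
      _ ◁ tensorμ _ _ _ _ ≫ (e₁ ⊗ₘ e₂ ⊗ₘ e₃) := by
        rw [← id_tensorHom, tensorHom_comp_tensorHom, Category.id_comp]
    rw [h1, h2, ← associator_monoidal_assoc]
    simp only [Category.assoc, associator_naturality]
  exact h

variable {S} in
/-- A naturality square for hom-objects commutes if the corresponding square of actions does. -/
lemma comp_post_eq_comp_pre {C D : Comon V} {A A' B B' : Mon V} {g : C ⟶ D} {h : C ⟶ S.P A B}
    {h' : D ⟶ S.P A' B'} {i : A ⟶ A'} {j : B ⟶ B'}
    (e : S.act h.hom ≫ j.hom = (g.hom ⊗ₘ i.hom) ≫ S.act h'.hom) :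
    h ≫ S.post A j = g ≫ h' ≫ S.pre i B' := by
  apply S.hom_ext
  rw [Comon.comp_hom', Comon.comp_hom', Comon.comp_hom', post_hom, pre_hom, act_comp_postHom,
    act_comp, act_comp_preHom, e, MonoidalCategory.tensorHom_def_assoc]

variable {S} in
/-- A naturality square for hom-objects commutes if the corresponding square of actions does. -/
lemma comp_pre_inv_eq_comp_post_inv {C D : Comon V} {A A' B B' : Mon V} {g : C ⟶ D}
    {h : C ⟶ S.P A B} {h' : D ⟶ S.P A' B'} {i : A ≅ A'} {j : B ≅ B'}
    (e : S.act h.hom ≫ j.hom.hom = (g.hom ⊗ₘ i.hom.hom) ≫ S.act h'.hom) :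
    h ≫ S.pre i.inv B = g ≫ h' ≫ S.post A' j.inv := by
  have hi : i.inv.hom ≫ i.hom.hom = 𝟙 _ := congrArg Mon.Hom.hom i.inv_hom_id
  have hj : j.hom.hom ≫ j.inv.hom = 𝟙 _ := congrArg Mon.Hom.hom j.hom_inv_id
  -- Since `i` and `j` are invertible, the square can be inverted; the opposite category needs this
  -- form.
  have e' : S.act h.hom = ((g.hom ⊗ₘ i.hom.hom) ≫ S.act h'.hom) ≫ j.inv.hom := by
    rw [← e, Category.assoc, hj, Category.comp_id]
  apply S.hom_ext
  rw [Comon.comp_hom', Comon.comp_hom', Comon.comp_hom', post_hom, pre_hom, act_comp_preHom,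
    act_comp S g.hom, act_comp_postHom, e', MonoidalCategory.tensorHom_def']
  simp only [Category.assoc]
  rw [← MonoidalCategory.whiskerLeft_comp_assoc, hi, MonoidalCategory.whiskerLeft_id,
    Category.id_comp]

lemma act_tens_associator (A₁ A₂ A₃ B₁ B₂ B₃ : Mon V) :
    S.act (S.tens A₁ A₂ B₁ B₂ ▷ S.P A₃ B₃ ≫ S.tens (A₁ ⊗ A₂) A₃ (B₁ ⊗ B₂) B₃).hom ≫
        (α_ B₁ B₂ B₃).hom.hom =
      (Comon.Hom.hom (α_ (S.P A₁ B₁) (S.P A₂ B₂) (S.P A₃ B₃)).hom ⊗ₘ (α_ A₁ A₂ A₃).hom.hom) ≫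
        S.act (S.P A₁ B₁ ◁ S.tens A₂ A₃ B₂ B₃ ≫ S.tens A₁ (A₂ ⊗ A₃) B₁ (B₂ ⊗ B₃)).hom := by
  rw [comon_associator_hom]
  exact S.act_tensHom_associator

lemma act_tens_leftUnitor (A B : Mon V) :
    S.act ((λ_ _).inv ≫ S.element (𝟙 (𝟙_ (Mon V))) ▷ S.P A B ≫
        S.tens (𝟙_ (Mon V)) A (𝟙_ (Mon V)) B).hom ≫ (λ_ B).hom.hom =
      (Comon.Hom.hom (𝟙 (S.P A B)) ⊗ₘ (λ_ A).hom.hom) ≫ S.act (Comon.Hom.hom (𝟙 (S.P A B))) := by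
  change S.act (Comon.Hom.hom (λ_ (S.P A B)).inv ≫
    S.elementHom (𝟙 (𝟙_ (Mon V))) ▷ (S.P A B).X ≫ S.tensHom _ _ _ _) ≫ (λ_ B.X).hom =
      (𝟙 (S.P A B).X ⊗ₘ (λ_ A.X).hom) ≫ S.act (𝟙 (S.P A B).X)
  rw [comon_leftUnitor_inv]
  change S.act ((λ_ (S.P A B).X).inv ≫
    S.elementHom (𝟙 (𝟙_ (Mon V))) ▷ (S.P A B).X ≫ S.tensHom _ _ _ _) ≫ (λ_ B.X).hom = _
  rw [S.act_comp (λ_ (S.P A B).X).inv, ← tensorHom_id (S.elementHom _), act_tensorHom_tensHom,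
    act_elementHom, act_id, id_tensorHom]
  have h {e : (S.P A B).X ⊗ A.X ⟶ B.X} :
      ((λ_ _).inv ▷ _ ≫ tensorμ (𝟙_ V) _ (𝟙_ V) _ ≫ ((λ_ (𝟙_ V)).hom ≫ 𝟙 _ ⊗ₘ e)) ≫
        (λ_ B.X).hom = _ ◁ (λ_ A.X).hom ≫ e := by
    have h1 := leftUnitor_monoidal (S.P A B).X A.X
    rw [Category.comp_id, Category.assoc, Category.assoc, MonoidalCategory.tensorHom_def,
      Category.assoc, leftUnitor_naturality, ← reassoc_of% h1]
    simp [MonoidalCategory.tensorHom_def]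
  exact h

lemma act_tens_rightUnitor (A B : Mon V) :
    S.act ((ρ_ _).inv ≫ S.P A B ◁ S.element (𝟙 (𝟙_ (Mon V))) ≫
        S.tens A (𝟙_ (Mon V)) B (𝟙_ (Mon V))).hom ≫ (ρ_ B).hom.hom =
      (Comon.Hom.hom (𝟙 (S.P A B)) ⊗ₘ (ρ_ A).hom.hom) ≫ S.act (Comon.Hom.hom (𝟙 (S.P A B))) := by
  change S.act (Comon.Hom.hom (ρ_ (S.P A B)).inv ≫
    (S.P A B).X ◁ S.elementHom (𝟙 (𝟙_ (Mon V))) ≫ S.tensHom _ _ _ _) ≫ (ρ_ B.X).hom =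
      (𝟙 (S.P A B).X ⊗ₘ (ρ_ A.X).hom) ≫ S.act (𝟙 (S.P A B).X)
  rw [comon_rightUnitor_inv]
  change S.act ((ρ_ (S.P A B).X).inv ≫
    (S.P A B).X ◁ S.elementHom (𝟙 (𝟙_ (Mon V))) ≫ S.tensHom _ _ _ _) ≫ (ρ_ B.X).hom = _
  rw [S.act_comp (ρ_ (S.P A B).X).inv, ← id_tensorHom _ (S.elementHom _), act_tensorHom_tensHom,
    act_elementHom, act_id, id_tensorHom]
  have h {e : (S.P A B).X ⊗ A.X ⟶ B.X} :
      ((ρ_ _).inv ▷ _ ≫ tensorμ _ (𝟙_ V) _ (𝟙_ V) ≫ (e ⊗ₘ (λ_ (𝟙_ V)).hom ≫ 𝟙 _)) ≫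
        (ρ_ B.X).hom = _ ◁ (ρ_ A.X).hom ≫ e := by
    have h1 := rightUnitor_monoidal (S.P A B).X A.X
    rw [Category.comp_id, Category.assoc, Category.assoc, MonoidalCategory.tensorHom_def',
      Category.assoc, rightUnitor_naturality, ← reassoc_of% h1]
    simp [MonoidalCategory.tensorHom_def]
  exact h

lemma act_tens_braiding (A₁ A₂ B₁ B₂ : Mon V) :
    S.act (S.tens A₁ A₂ B₁ B₂).hom ≫ (β_ B₁ B₂).hom.hom =
      (Comon.Hom.hom (β_ (S.P A₁ B₁) (S.P A₂ B₂)).hom ⊗ₘ (β_ A₁ A₂).hom.hom) ≫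
        S.act (S.tens A₂ A₁ B₂ B₁).hom := by
  change S.act (S.tensHom A₁ A₂ B₁ B₂) ≫ (β_ B₁.X B₂.X).hom =
      ((β_ (S.P A₁ B₁).X (S.P A₂ B₂).X).hom ⊗ₘ (β_ A₁.X A₂.X).hom) ≫ S.act (S.tensHom A₂ A₁ B₂ B₁)
  rw [act_tensHom, act_tensHom]
  have h {e₁ : (S.P A₁ B₁).X ⊗ A₁.X ⟶ B₁.X} {e₂ : (S.P A₂ B₂).X ⊗ A₂.X ⟶ B₂.X} :
      (tensorμ _ _ _ _ ≫ (e₁ ⊗ₘ e₂)) ≫ (β_ _ _).hom =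
        ((β_ _ _).hom ⊗ₘ (β_ _ _).hom) ≫ tensorμ _ _ _ _ ≫ (e₂ ⊗ₘ e₁) := by
    rw [Category.assoc, BraidedCategory.braiding_naturality,
      ← reassoc_of% tensorμ_comp_braiding_interchange]
  exact h

end Tensor

end SweedlerHom

end SweedlerTheory
namespace SweedlerTheory

namespace SweedlerHom

/-! ### The symmetric monoidal structure on `Mon(V)ᵒᵖ`. -/

section SymmetricOp

variable {V : Type u} [Category.{v} V] [MonoidalCategory.{v} V] [MonoidalClosed V]
  [SymmetricCategory V] (S : SweedlerHom V)

lemma tens_element_id (A B : Mon V) :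
    (λ_ _).inv ≫ (S.element (𝟙 A) ⊗ₘ S.element (𝟙 B)) ≫ S.tens A B A B =
      S.element (𝟙 (A ⊗ B)) := by
  rw [tens_element, id_tensorHom_id]

/-- The symmetric monoidal structure of the enrichment of `Mon(V)ᵒᵖ` in `Comon(V)`. -/
noncomputable def opSymmetricMonoidalStructure :
    letI := S.opEnrichment
    EnrichedSymmetricMonoidalStructure (Comon V) (Mon V)ᵒᵖ :=
  letI := S.opEnrichment
  { tensorMap X₁ Y₁ X₂ Y₂ := S.tens Y₁.unop Y₂.unop X₁.unop X₂.unop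
    tensorMap_id X₁ X₂ := S.tens_element_id X₁.unop X₂.unop
    tensorMap_comp X₁ Y₁ Z₁ X₂ Y₂ Z₂ :=
      S.tens_comp Z₁.unop Z₂.unop Y₁.unop Y₂.unop X₁.unop X₂.unop
    tensorMap_homEquiv f g := S.tens_element f.unop g.unop
    associator_natural X₁ Y₁ X₂ Y₂ X₃ Y₃ := by
      -- The associator of the opposite category is the opposite of an inverse associator, and
      -- postcomposition there is precomposition in `Mon V`.
      have h := comp_pre_inv_eq_comp_post_inv (S.act_tens_associator Y₁.unop Y₂.unop Y₃.unop
        X₁.unop X₂.unop X₃.unop)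
      rw [Category.assoc, Category.assoc] at h
      exact h
    leftUnitor_natural X Y := by
      have h := comp_pre_inv_eq_comp_post_inv (S.act_tens_leftUnitor Y.unop X.unop)
      rw [Category.assoc, Category.assoc, Category.id_comp, Category.id_comp] at h
      exact h
    rightUnitor_natural X Y := by
      have h := comp_pre_inv_eq_comp_post_inv (S.act_tens_rightUnitor Y.unop X.unop)
      rw [Category.assoc, Category.assoc, Category.id_comp, Category.id_comp] at h
      exact h
    braiding_natural X₁ Y₁ X₂ Y₂ := by
      have h := S.act_tens_braiding Y₁.unop Y₂.unop X₁.unop X₂.unop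
      -- The symmetry of the opposite category is the opposite of a symmetry, so the symmetries are
      -- first rewritten as inverses to match the criterion.
      rw [SymmetricCategory.braiding_swap_eq_inv_braiding X₂.unop X₁.unop,
        SymmetricCategory.braiding_swap_eq_inv_braiding Y₂.unop Y₁.unop] at h
      exact comp_pre_inv_eq_comp_post_inv (i := (β_ Y₂.unop Y₁.unop).symm)
        (j := (β_ X₂.unop X₁.unop).symm) h }

lemma opTensorCompatible :
    letI := S.opEnrichment
    S.OpTensorCompatible S.isOpEnrichment_opEnrichment
      S.opSymmetricMonoidalStructure.toEnrichedMonoidalStructure := by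
  intro A B C D
  change S.act (S.tensHom A B C D ≫ 𝟙 _) =
    (𝟙 (S.P A C).X ⊗ₘ 𝟙 (S.P B D).X) ▷ (A.X ⊗ B.X) ≫ _
  rw [Category.comp_id, act_tensHom, id_tensorHom_id, id_whiskerRight, Category.id_comp]

end SymmetricOp

/-! ### The enrichment of `Mon(V)` and its symmetric monoidal structure. -/

section SymmetricMon

variable {V : Type u} [Category.{v} V] [MonoidalCategory.{v} V] [MonoidalClosed V]
  [SymmetricCategory V] (S : SweedlerHom V)

/-- The symmetry moves the element to the other factor. With the next lemma this identifies the
whiskerings of the enrichment with `pre` and `post`. -/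
lemma whiskerRight_element_comp {A B : Mon V} (f : A ⟶ B) (C : Mon V) :
    (λ_ (S.P B C)).inv ≫ S.element f ▷ _ ≫ (β_ _ _).hom ≫ S.comp A B C = S.pre f C := by
  rw [BraidedCategory.braiding_naturality_left_assoc, leftUnitor_inv_braiding_assoc]
  rfl

lemma whiskerLeft_element_comp (A : Mon V) {B C : Mon V} (g : B ⟶ C) :
    (ρ_ (S.P A B)).inv ≫ _ ◁ S.element g ≫ (β_ _ _).hom ≫ S.comp A B C = S.post A g := by
  rw [BraidedCategory.braiding_naturality_right_assoc, rightUnitor_inv_braiding_assoc]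
  rfl

/-- Follows from `comp_assoc` by naturality of the braiding and the hexagon identities. -/
lemma braiding_comp_assoc (A B C D : Mon V) :
    (α_ (S.P A B) (S.P B C) (S.P C D)).inv ≫ ((β_ _ _).hom ≫ S.comp A B C) ▷ _ ≫
        (β_ _ _).hom ≫ S.comp A C D =
      _ ◁ ((β_ _ _).hom ≫ S.comp B C D) ≫ (β_ _ _).hom ≫ S.comp A B D := by
  simp only [BraidedCategory.braiding_naturality_left_assoc, MonoidalCategory.whiskerLeft_comp,
    Category.assoc]
  rw [← S.comp_assoc]
  simp only [BraidedCategory.braiding_tensor_left_hom, Category.assoc, Iso.inv_hom_id_assoc,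
    BraidedCategory.braiding_naturality_right_assoc, BraidedCategory.braiding_tensor_right_hom]

lemma element_comp_braiding {A B C : Mon V} (f : A ⟶ B) (g : B ⟶ C) :
    S.element (f ≫ g) =
      (λ_ _).inv ≫ (S.element f ⊗ₘ S.element g) ≫ (β_ _ _).hom ≫ S.comp A B C := by
  rw [BraidedCategory.braiding_naturality_assoc, leftUnitor_inv_braiding_assoc, element_comp,
    unitors_inv_equal]

/-- The enrichment of `Mon(V)` in `Comon(V)` with hom-objects `Mon(V)(A, B) = P(A, B)`. -/
@[reducible]
noncomputable def enrichment : EnrichedOrdinaryCategory (Comon V) (Mon V) where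
  Hom A B := S.P A B
  id A := S.element (𝟙 A)
  comp A B C := (β_ _ _).hom ≫ S.comp A B C
  id_comp A B := (S.whiskerRight_element_comp (𝟙 A) B).trans (S.pre_id A B)
  comp_id A B := (S.whiskerLeft_element_comp A (𝟙 B)).trans (S.post_id A B)
  assoc A B C D := S.braiding_comp_assoc A B C D
  homEquiv {A B} := S.elementEquiv A B
  homEquiv_id _ := rfl
  homEquiv_comp f g := S.element_comp_braiding f g

lemma isEnrichment_enrichment : S.IsEnrichment S.enrichment where
  hom_eq _ _ := rfl
  homEquiv_ev {A B} f := by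
    change (λ_ A.X).inv ≫ S.act (S.elementHom f ≫ 𝟙 _) = f.hom
    rw [Category.comp_id, act_elementHom, Iso.inv_hom_id_assoc]
  comp_ev A B C := by
    change S.act (((β_ (S.P A B).X (S.P B C).X).hom ≫ S.compHom A B C) ≫ 𝟙 _) =
      (𝟙 (S.P A B).X ⊗ₘ 𝟙 (S.P B C).X) ▷ A.X ≫ _
    rw [Category.comp_id, act_comp, act_compHom, id_tensorHom_id, id_whiskerRight,
      Category.id_comp]

/-- Follows from `tens_comp`, since `tensorμ` carries the symmetry of two tensor products to the
tensor product of the symmetries. -/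
lemma tens_braiding_comp (A₁ B₁ C₁ A₂ B₂ C₂ : Mon V) :
    (S.tens A₁ A₂ B₁ B₂ ⊗ₘ S.tens B₁ B₂ C₁ C₂) ≫ (β_ _ _).hom ≫
        S.comp (A₁ ⊗ A₂) (B₁ ⊗ B₂) (C₁ ⊗ C₂) =
      tensorμ _ _ _ _ ≫ ((β_ _ _).hom ≫ S.comp A₁ B₁ C₁ ⊗ₘ (β_ _ _).hom ≫ S.comp A₂ B₂ C₂) ≫
        S.tens A₁ A₂ C₁ C₂ := by
  rw [BraidedCategory.braiding_naturality_assoc, tens_comp, ← tensorHom_comp_tensorHom_assoc,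
    reassoc_of% tensorμ_comp_tensorHom_braiding]

/-- The symmetric monoidal structure of the enrichment of `Mon(V)` in `Comon(V)`. -/
noncomputable def symmetricMonoidalStructure :
    letI := S.enrichment
    EnrichedSymmetricMonoidalStructure (Comon V) (Mon V) :=
  letI := S.enrichment
  { tensorMap A₁ B₁ A₂ B₂ := S.tens A₁ A₂ B₁ B₂
    tensorMap_id A₁ A₂ := S.tens_element_id A₁ A₂
    tensorMap_comp A₁ B₁ C₁ A₂ B₂ C₂ := S.tens_braiding_comp A₁ B₁ C₁ A₂ B₂ C₂
    tensorMap_homEquiv f g := S.tens_element f g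
    associator_natural A₁ B₁ A₂ B₂ A₃ B₃ := by
      have h := comp_post_eq_comp_pre (S.act_tens_associator A₁ A₂ A₃ B₁ B₂ B₃)
      rw [Category.assoc, Category.assoc, ← whiskerRight_element_comp,
        ← whiskerLeft_element_comp] at h
      exact h
    leftUnitor_natural A B := by
      have h := comp_post_eq_comp_pre (S.act_tens_leftUnitor A B)
      rw [Category.assoc, Category.assoc, Category.id_comp, Category.id_comp,
        ← whiskerRight_element_comp, ← whiskerLeft_element_comp] at h
      exact h
    rightUnitor_natural A B := by
      have h := comp_post_eq_comp_pre (S.act_tens_rightUnitor A B)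
      rw [Category.assoc, Category.assoc, Category.id_comp, Category.id_comp,
        ← whiskerRight_element_comp, ← whiskerLeft_element_comp] at h
      exact h
    braiding_natural A₁ B₁ A₂ B₂ := by
      have h := comp_post_eq_comp_pre (S.act_tens_braiding A₁ A₂ B₁ B₂)
      rw [← whiskerRight_element_comp, ← whiskerLeft_element_comp] at h
      exact h }

lemma tensorCompatible :
    letI := S.enrichment
    S.TensorCompatible S.isEnrichment_enrichment
      S.symmetricMonoidalStructure.toEnrichedMonoidalStructure := by
  intro A B C D
  change S.act (S.tensHom A B C D ≫ 𝟙 _) =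
    (𝟙 (S.P A C).X ⊗ₘ 𝟙 (S.P B D).X) ▷ (A.X ⊗ B.X) ≫ _
  rw [Category.comp_id, act_tensHom, id_tensorHom_id, id_whiskerRight, Category.id_comp]

end SymmetricMon

end SweedlerHom

end SweedlerTheory

open SweedlerTheory in
theorem mainTheorem4 (V : Type u) [Category.{v} V] [MonoidalCategory.{v} V] [MonoidalClosed V]
    [IsLocallyPresentable.{v} V] :
    (∀ [BraidedCategory V],
      Nonempty (SweedlerHom V) ∧
      ∀ S : SweedlerHom V,
        ∃ E : EnrichedOrdinaryCategory (Comon V) (Mon V)ᵒᵖ, S.IsOpEnrichment E) ∧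
    (∀ [SymmetricCategory V] (S : SweedlerHom V),
      (∃ (E : EnrichedOrdinaryCategory (Comon V) (Mon V)ᵒᵖ) (h : S.IsOpEnrichment E)
        (T : EnrichedSymmetricMonoidalStructure (Comon V) (Mon V)ᵒᵖ),
        S.OpTensorCompatible h T.toEnrichedMonoidalStructure) ∧
      (∃ (E : EnrichedOrdinaryCategory (Comon V) (Mon V)) (h : S.IsEnrichment E)
        (T : EnrichedSymmetricMonoidalStructure (Comon V) (Mon V)),
        S.TensorCompatible h T.toEnrichedMonoidalStructure)) := by
  refine ⟨?_, ?_⟩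
  · intro _
    exact ⟨nonempty_sweedlerHom V, fun S => ⟨S.opEnrichment, S.isOpEnrichment_opEnrichment⟩⟩
  · intro _ S
    exact ⟨⟨S.opEnrichment, S.isOpEnrichment_opEnrichment, S.opSymmetricMonoidalStructure,
        S.opTensorCompatible⟩,
      ⟨S.enrichment, S.isEnrichment_enrichment, S.symmetricMonoidalStructure,
        S.tensorCompatible⟩⟩
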